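/- Let $\mathbb F_q$ be a finite field of characteristic $p$, let $j,k\ge 1$ be coprime integers with $p\nmid k$, let $m=j+k$ and $n\ge 1$, and let $K=\mathbb F_{q^m}$. For an extension field $L$ of $K$ with algebraic closure $\bar L$, let $\mathcal D_{m,j}(L)$ be the set of normalized Drinfeld modules $\phi:A=\mathbb F_q[T]\to L\{\tau\}$, $\phi_T=-\tau^m+g\tau^j+1$ with $g\in L$, where $\tau$ is the $q$-Frobenius; $\phi$ makes $\bar L$ an $A$-module. Put $F(T)=1-(1-T)^k=T f(T)$, $f(T)=\sum_{i=1}^k\binom ki(-T)^{i-1}$, and let $\Phi:A\to L\{\tau\}$ be given by $\Phi_T=\phi_{F(T)}$. As $\Phi_T$ is a polynomial in $\tau^k$, it makes $\bar L$ a module over $A_k=\mathbb F_{q^k}[T]$, where $\mathbb F_{q^k}\subseteq\bar L$ acts by multiplication and $T$ acts by $\Phi_T$. Let $\ddot X_{m,j}(T^n)(L)$ be the set of triples $(\phi,G_n,x)$ where $\phi\in\mathcal D_{m,j}(L)$, $G_n\subseteq\operatorname{Ker}\phi_{T^n}$ is an $A$-submodule stable under $\operatorname{Aut}(\bar L/L)$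 with $G_n\cong A/T^nA$, and $0\ne x\in G_n\cap\operatorname{Ker}(\phi_T)\cap L$. Let $\ddot M_{m,j}(T^n)(L)$ be the set of triples $(\phi,E_n,x)$ where $\phi\in\mathcal D_{m,j}(L)$, $E_n\subseteq\operatorname{Ker}\Phi_{T^n}$ is an $\mathbb F_{q^k}$-subspace stable under $\operatorname{Aut}(\bar L/L)$ that is an $A$-submodule (for $\phi$) isomorphic to $A/F(T)^nA$ and an $A_k$-submodule (for $\Phi$) isomorphic to $A_k/T^nA_k$, and $0\neq x\in\phi_{T^{n-1}f(T)^n}E_n\cap L$. Take as coordinates of a triple $(\phi,V,x)$ the coefficient $g$ of $\phi$, the element $x$, and the non-leading coefficients of $\prod_{\gamma\in V}(Y-\gamma)$. Let the Drinfeld modular curve $\ddot X_{m,j}(T^n)$ and the twisted Drinfeld modular curve $\ddot M_{m,j}(T^n)$ be the reduced affine $K$-schemes $\operatorname{Spec}$ of the polynomial ring over $K$ in these coordinates modulo the ideal of polynomials that vanish at all triples of the respective kind over all extension fields $L$ of $K$. **Theorem.** There is an isomorphism $e:\ddot M_{m,j}(T^n)\to\ddot X_{m,j}(T^n)$ of schemes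 over $K=\mathbb F_{q^m}$ such that for every extension field $L$ of $K$ the following holds. Taking coordinates identifies the $L$-points over $K$ of the scheme $\ddot M_{m,j}(T^n)$ (respectively $\ddot X_{m,j}(T^n)$) bijectively with the set of triples $\ddot M_{m,j}(T^n)(L)$ (respectively $\ddot X_{m,j}(T^n)(L)$), and under these identifications $e$ is on $L$-points the map $$(\phi,E_n,x)\mapsto(\phi,\phi_{f(T)^n}E_n,x),$$ which is a well-defined bijection, with inverse $$(\phi,G_n,x)\mapsto(\phi,\mathbb F_{q^k}\langle G_n\rangle,x),$$ where $\mathbb F_{q^k}\langle G_n\rangle$ is the $\mathbb F_{q^k}$-subspace of $\bar L$ spanned by $G_n$. -/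

import Mathlib

open Polynomial CategoryTheory AlgebraicGeometry

universe u

namespace DrinfeldCurve

noncomputable section

/-! ### Twisted polynomials and normalized Drinfeld modules

Throughout, `F` is the finite field with `q` elements, `A = F[T]` is `F[X]`, `L` is an extension
field of `F`, and the algebraic closure of `L` is `AlgebraicClosure L`. -/

section Drinfeld

variable (F : Type u) [Field F] [Fintype F] (L : Type u) [Field L] [Algebra F L]

/-- The `q`-Frobenius `τ : y ↦ y ^ q`, as an `F`-linear endomorphism of the algebraic closure
of `L`. -/
def tau : Module.End F (AlgebraicClosure L) :=
  (FiniteField.frobeniusAlgHom F (AlgebraicClosure L)).toLinearMap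

variable {L} in
/-- Multiplication by an element `c` of `L`, as an `F`-linear endomorphism of the algebraic closure
of `L`. -/
def scalar (c : L) : Module.End F (AlgebraicClosure L) :=
  LinearMap.mulLeft F (algebraMap L (AlgebraicClosure L) c)

/-- The twisted polynomial ring `L{τ}`, realised through its (faithful) action on the algebraic
closure of `L`: the `F`-algebra of endomorphisms generated by the scalars in `L` and by `τ`. Its
elements are the maps `y ↦ ∑ cᵢ y ^ (q ^ i)` with `cᵢ ∈ L`, and `τ c = c ^ q τ`. -/
def TwistedPolynomial : Subalgebra F (Module.End F (AlgebraicClosure L)) :=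
  Algebra.adjoin F (insert (tau F L) (Set.range (scalar F (L := L))))

/-- The set `𝒟_{m,j}`, `m = j + k`, of normalized Drinfeld modules over `L`: the homomorphisms of
`F`-algebras `φ : F[T] → L{τ}` with `φ_T = -τ ^ m + g τ ^ j + 1` for some `g ∈ L`. (The element `g`
is determined by `φ`, being equal to `φ_T(1)`.) -/
structure NormalizedDrinfeldModule (j k : ℕ) where
  toAlgHom : F[X] →ₐ[F] TwistedPolynomial F L
  g : L
  map_T : (toAlgHom X : Module.End F (AlgebraicClosure L)) =
    -(tau F L) ^ (j + k) + scalar F g * (tau F L) ^ j + 1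

variable {F L}

/-- `φ_a`, as an endomorphism of the algebraic closure of `L`. -/
def NormalizedDrinfeldModule.act {j k : ℕ} (φ : NormalizedDrinfeldModule F L j k) (a : F[X]) :
    Module.End F (AlgebraicClosure L) :=
  (φ.toAlgHom a : Module.End F (AlgebraicClosure L))

/-- Let `ρ` be the action of a commutative ring `R` on an `F`-module `Ω` by endomorphisms. The
subgroup `V` of `Ω` is an `R`-submodule (for the action `ρ`) that is isomorphic to `R ⧸ I` as an
`R`-module. -/
def IsSubmoduleIsoQuotient {Ω : Type u} [AddCommGroup Ω] [Module F Ω] {R : Type u} [CommRing R]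
    (ρ : R → Module.End F Ω) (V : AddSubgroup Ω) (I : Ideal R) : Prop :=
  ∃ ψ : V ≃+ (R ⧸ I), ∀ (r : R) (v : V), ∃ h : ρ r v ∈ V,
    ψ ⟨ρ r v, h⟩ = Ideal.Quotient.mk I r * ψ v

/-- `V` is stable under `Aut(Lᵃˡᵍ / L)`: `ξ(V) = V` for all `ξ`. -/
def IsGaloisStable (V : Set (AlgebraicClosure L)) : Prop :=
  ∀ ξ : AlgebraicClosure L ≃ₐ[L] AlgebraicClosure L, ξ '' V = V

/-- `𝒢(N; φ)`: the Galois stable `A`-submodules `G` of `Ker φ_N` with `G ≅ A / N A`. -/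
def levelX {j k : ℕ} (φ : NormalizedDrinfeldModule F L j k) (N : F[X]) :
    Set (Submodule F (AlgebraicClosure L)) :=
  {G | G ≤ LinearMap.ker (φ.act N) ∧
    IsSubmoduleIsoQuotient φ.act G.toAddSubgroup (Ideal.span {N}) ∧
    IsGaloisStable (G : Set (AlgebraicClosure L))}

variable (F) in
/-- `F(T) = 1 - (1 - T) ^ k`. -/
def bigF (k : ℕ) : F[X] := 1 - (1 - X) ^ k

variable (F) in
/-- `f(T) = ∑_{i = 1}^{k} (k choose i) (-T) ^ (i - 1)`, so that `F(T) = T f(T)`. -/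
def smallF (k : ℕ) : F[X] := ∑ i ∈ Finset.Icc 1 k, (k.choose i : F[X]) * (-X) ^ (i - 1)

/-- `Φ_a = φ_{a(F(T))}`, where `Φ` is the homomorphism with `Φ_T = φ_{F(T)}`. -/
def NormalizedDrinfeldModule.bigAct {j k : ℕ} (φ : NormalizedDrinfeldModule F L j k) (a : F[X]) :
    Module.End F (AlgebraicClosure L) :=
  φ.act (a.comp (bigF F k))

variable (F L) in
/-- The field `𝔽_{q^k}` inside the algebraic closure of `L`: the elements `μ` with
`μ ^ (q ^ k) = μ`. -/
def fqk (k : ℕ) : Subfield (AlgebraicClosure L) :=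
  RingHom.eqLocusField
    ((FiniteField.frobeniusAlgHom F (AlgebraicClosure L)) ^ k).toRingHom
    (RingHom.id (AlgebraicClosure L))

/-- The action of `A_k = 𝔽_{q^k}[T]` on the algebraic closure of `L` that `Φ` defines: `T` acts by
`Φ_T`, and elements of `𝔽_{q^k}` act by multiplication. -/
def NormalizedDrinfeldModule.actK {j k : ℕ} (φ : NormalizedDrinfeldModule F L j k)
    (a : (fqk F L k)[X]) : Module.End F (AlgebraicClosure L) :=
  a.eval₂ ((Algebra.lmul F (AlgebraicClosure L)).toRingHom.comp (fqk F L k).subtype)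
    (φ.bigAct X)

/-- `ℰ_n(φ)`: the Galois stable `𝔽_{q^k}`-subspaces `E` of `Ker Φ_{T^n}` with `E ≅ A / F(T)^n A` as
an `A`-submodule (action of `φ`) and `E ≅ A_k / T^n A_k` as an `A_k`-submodule (action of `Φ`). -/
def levelM {j k : ℕ} (φ : NormalizedDrinfeldModule F L j k) (n : ℕ) :
    Set (Submodule (fqk F L k) (AlgebraicClosure L)) :=
  {E | (∀ v ∈ E, φ.bigAct (X ^ n) v = 0) ∧
    IsGaloisStable (E : Set (AlgebraicClosure L)) ∧
    IsSubmoduleIsoQuotient φ.act E.toAddSubgroup (Ideal.span {(bigF F k) ^ n}) ∧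
    IsSubmoduleIsoQuotient φ.actK E.toAddSubgroup (Ideal.span {(X : (fqk F L k)[X]) ^ n})}

variable (F L) in
/-- The triples `(φ, G, x)` over `L` that `Ẍ_{m,j}(T^n)`, `m = j + k`, parameterizes: `φ ∈ 𝒟_{m,j}`,
`G ∈ 𝒢(T^n; φ)`, and a nonzero `x ∈ G ∩ Ker φ_T ∩ L`. -/
structure XTriple (j k n : ℕ) where
  φ : NormalizedDrinfeldModule F L j k
  G : Submodule F (AlgebraicClosure L)
  G_mem : G ∈ levelX φ (X ^ n)
  x : L
  x_ne_zero : x ≠ 0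
  x_mem : algebraMap L (AlgebraicClosure L) x ∈ G ⊓ LinearMap.ker (φ.act X)

variable (F L) in
/-- The triples `(φ, E, x)` over `L` that `M̈_{m,j}(T^n)`, `m = j + k`, parameterizes: `φ ∈ 𝒟_{m,j}`,
`E ∈ ℰ_n(φ)`, and a nonzero `x ∈ φ_{T^{n-1} f(T)^n}(E) ∩ L`. (Here `n ≥ 1`.) -/
structure MTriple (j k n : ℕ) where
  φ : NormalizedDrinfeldModule F L j k
  E : Submodule (fqk F L k) (AlgebraicClosure L)
  E_mem : E ∈ levelM φ n
  x : L
  x_ne_zero : x ≠ 0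
  x_mem : algebraMap L (AlgebraicClosure L) x ∈
    φ.act (X ^ (n - 1) * (smallF F k) ^ n) '' (E : Set (AlgebraicClosure L))

/-! ### The curves

A finite subgroup `V` of the additive group is given by its equation `∏_{γ ∈ V} (X - γ) = 0`, and so
a triple `(φ, V, x)` by the coefficient `g` of `φ`, the marked point `x` and the coefficients of that
equation. -/

/-- Names of the coordinates of a triple `(φ, V, x)`, where `V` has `d` elements. -/
inductive Coord (d : ℕ) : Type u
  | g : Coord d
  | x : Coord d
  | coeff (i : Fin d) : Coord d

/-- The monic polynomial whose roots are the elements of the finite set `V`, each simple. -/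
def equation (V : Set (AlgebraicClosure L)) : (AlgebraicClosure L)[X] :=
  ∏ᶠ γ ∈ V, (X - C γ)

/-- The coordinates of `(φ, G, x)`; the subgroup `G` has `q ^ n` elements. -/
def XTriple.coord {j k n : ℕ} (t : XTriple F L j k n) :
    Coord.{u} (Fintype.card F ^ n) → AlgebraicClosure L
  | .g => algebraMap L (AlgebraicClosure L) t.φ.g
  | .x => algebraMap L (AlgebraicClosure L) t.x
  | .coeff i => (equation (t.G : Set (AlgebraicClosure L))).coeff i

/-- The coordinates of `(φ, E, x)`; the subgroup `E` has `q ^ (k n)` elements. -/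
def MTriple.coord {j k n : ℕ} (t : MTriple F L j k n) :
    Coord.{u} (Fintype.card F ^ (k * n)) → AlgebraicClosure L
  | .g => algebraMap L (AlgebraicClosure L) t.φ.g
  | .x => algebraMap L (AlgebraicClosure L) t.x
  | .coeff i => (equation (t.E : Set (AlgebraicClosure L))).coeff i

end Drinfeld

section Curves

variable (F : Type u) [Field F] [Fintype F] (K : Type u) [Field K] [Algebra F K]

/-- The ideal of all polynomials over `K` that vanish at all triples `(φ, G, x)` over all extension
fields `L` of `K`. -/
def idealX (j k n : ℕ) : Ideal (MvPolynomial (Coord.{u} (Fintype.card F ^ n)) K) :=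
  ⨅ (L : Type u) (_ : Field L) (_ : Algebra F L) (_ : Algebra K L) (_ : IsScalarTower F K L)
    (t : XTriple F L j k n), RingHom.ker (MvPolynomial.aeval (R := K) t.coord)

/-- The ideal of all polynomials over `K` that vanish at all triples `(φ, E, x)` over all extension
fields `L` of `K`. -/
def idealM (j k n : ℕ) : Ideal (MvPolynomial (Coord.{u} (Fintype.card F ^ (k * n))) K) :=
  ⨅ (L : Type u) (_ : Field L) (_ : Algebra F L) (_ : Algebra K L) (_ : IsScalarTower F K L)
    (t : MTriple F L j k n), RingHom.ker (MvPolynomial.aeval (R := K) t.coord)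

/-- The affine coordinate ring of `Ẍ_{m,j}(T^n)` over `K`, `m = j + k`. -/
abbrev CoordRingX (j k n : ℕ) : Type u :=
  MvPolynomial (Coord.{u} (Fintype.card F ^ n)) K ⧸ idealX F K j k n

/-- The affine coordinate ring of `M̈_{m,j}(T^n)` over `K`, `m = j + k`. -/
abbrev CoordRingM (j k n : ℕ) : Type u :=
  MvPolynomial (Coord.{u} (Fintype.card F ^ (k * n))) K ⧸ idealM F K j k n

/-- The affine scheme `Spec S` as a scheme over `Spec K`. -/
abbrev specOver (S : Type u) [CommRing S] [Algebra K S] : Over (Spec (CommRingCat.of K)) :=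
  Over.mk (Spec.map (CommRingCat.ofHom (algebraMap K S)))

/-- The Drinfeld modular curve `Ẍ_{m,j}(T^n)` over `K`, `m = j + k`: the reduced affine scheme over
`K` whose points are the triples `(φ, G, x)`. -/
abbrev curveX (j k n : ℕ) : Over (Spec (CommRingCat.of K)) := specOver K (CoordRingX F K j k n)

/-- The twisted Drinfeld modular curve `M̈_{m,j}(T^n)` over `K`, `m = j + k`: the reduced affine
scheme over `K` whose points are the triples `(φ, E, x)`. -/
abbrev curveM (j k n : ℕ) : Over (Spec (CommRingCat.of K)) := specOver K (CoordRingM F K j k n)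

variable {K} in
/-- The value at an `S'`-point `P` of `Spec S` of the regular function `s`. -/
def valueAt {S S' : Type u} [CommRing S] [Algebra K S] [CommRing S'] [Algebra K S']
    (P : specOver K S' ⟶ specOver K S) (s : S) : S' :=
  (Spec.preimage P.left).hom s

end Curves

end

end DrinfeldCurve

/-! Since φ_{1-T} = τ^{j+k} - gτ^j and τ^k is trivial on 𝔽_{q^k}, one has φ_{1-T}(μv) = μ^{q^j}
φ_{1-T}(v) for μ in that field (`act_pow_one_sub_X_mul`). Hence φ_{(1-T)^k}, and with it Φ_T, is
𝔽_{q^k}-linear. Moreover F(T) = T f(T) with f(0) = k ≠ 0 in F, so T and f(T) are coprime and F(T)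
generates A/T^nA as an F-algebra.

Let G = Av have annihilator T^n. By the last remark the 𝔽_{q^k}-span of G is A_k v, with annihilator
T^n in A_k (`span_orbit_eq`, `actK_eq_zero_iff`), so it has q^{kn} elements. It is also cyclic over
A, generated by lv for a normal element l of 𝔽_{q^k}: powers of 1-T twist l into its conjugates, up
to errors deeper in the T-filtration (`exists_orbit_eq_orbitK`). Counting identifies the
A-annihilator as F(T)^n. Conversely φ_{f(T)^n} cuts the T^n-torsion out of E ≅ A/T^nA × A/f(T)^nA.
Inclusions and cardinalities show that the two constructions are inverse (`image_span_eq`,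
`span_image_eq`), and the conditions on x match because φ_{T^{n-1}}G = G ∩ Ker φ_T.

For the schemes, each kind of coordinates must be polynomial in the other. From E to G, a polynomial
that is the identity on G and zero on the rest of E turns the equation of E into that of G times a
power of Y (`exists_coordX_eq_aeval_coordM`). From G to E, the elements of E are the combinations of
k elements of G with coefficients in a basis of 𝔽_{q^k}; iterated resultants give the equation of E,
and a trace brings its coefficients down to F (`exists_coordM_eq_aeval_coordX`). As the ideals
consist of everything that vanishes at the triples, the coordinate rings are isomorphic.

It remains to see that L-points of Ẍ are triples. A triple has coordinates in L because Ker φ_{T^n}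
is separable. Conversely, a few explicit equations force a tuple to come from a triple
(`exists_XTriple_of_forall_aeval_eq_zero`). The points of M̈ are then obtained through the
isomorphism. -/

namespace DrinfeldCurve

noncomputable section

/-! ### Cyclic modules -/

section Cyclic

variable {F Ω R : Type u} [Field F] [AddCommGroup Ω] [Module F Ω] [CommRing R]

/-- The subgroup `V` is generated over `R` by a single element with annihilator `I`. -/
def IsCyclicWithAnnihilator (ρ : R →+* Module.End F Ω) (V : AddSubgroup Ω) (I : Ideal R) : Prop :=
  ∃ v : Ω, (∀ w, w ∈ V ↔ ∃ r, ρ r v = w) ∧ ∀ r, ρ r v = 0 ↔ r ∈ I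

theorem isSubmoduleIsoQuotient_iff (ρ : R →+* Module.End F Ω) (V : AddSubgroup Ω) (I : Ideal R) :
    IsSubmoduleIsoQuotient ρ V I ↔ IsCyclicWithAnnihilator ρ V I := by
  constructor
  · rintro ⟨ψ, hψ⟩
    let v : V := ψ.symm 1
    have key : ∀ r : R, ∃ h : ρ r v ∈ V, ψ ⟨ρ r v, h⟩ = Ideal.Quotient.mk I r := fun r => by
      obtain ⟨h, e⟩ := hψ r v
      exact ⟨h, by rw [e]; simp [v]⟩
    refine ⟨v, fun w => ⟨fun hw => ?_, ?_⟩, fun r => ?_⟩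
    · obtain ⟨r, hr⟩ := Ideal.Quotient.mk_surjective (ψ ⟨w, hw⟩)
      obtain ⟨h, e⟩ := key r
      exact ⟨r, congrArg Subtype.val (ψ.injective (e.trans hr))⟩
    · rintro ⟨r, rfl⟩
      exact (key r).1
    · obtain ⟨h, e⟩ := key r
      rw [← Ideal.Quotient.eq_zero_iff_mem, ← e, map_eq_zero_iff _ ψ.injective]
      simp [Subtype.ext_iff]
  · rintro ⟨v, hV, hI⟩
    let f : R →+ V :=
      { toFun := fun r => ⟨ρ r v, (hV _).2 ⟨r, rfl⟩⟩
        map_zero' := by simp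
        map_add' := fun a b => by ext; simp }
    have hf : Function.Surjective f := fun w => by
      obtain ⟨r, hr⟩ := (hV w).1 w.2
      exact ⟨r, Subtype.ext hr⟩
    have hker : ∀ r, f r = 0 ↔ r ∈ I := fun r => by rw [← hI]; simp [f, Subtype.ext_iff]
    let g : (R ⧸ I) →+ V := QuotientAddGroup.lift I.toAddSubgroup f fun r hr => (hker r).2 hr
    have hg : ∀ r, g (Ideal.Quotient.mk I r) = f r := fun r => rfl
    have hbij : Function.Bijective g := by
      refine ⟨(injective_iff_map_eq_zero g).2 fun x hx => ?_, fun w => ?_⟩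
      · obtain ⟨r, rfl⟩ := Ideal.Quotient.mk_surjective x
        rw [hg, hker] at hx
        exact Ideal.Quotient.eq_zero_iff_mem.2 hx
      · obtain ⟨r, hr⟩ := hf w
        exact ⟨_, (hg r).trans hr⟩
    let ψ := AddEquiv.ofBijective g hbij
    refine ⟨ψ.symm, fun r w => ?_⟩
    obtain ⟨s, rfl⟩ := hf w
    have e : ρ r (f s) = f (r * s) := by simp [f]
    refine ⟨by rw [e]; exact (f (r * s)).2, ?_⟩
    have e2 : ∀ s, ψ.symm (f s) = Ideal.Quotient.mk I s := fun s => by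
      rw [AddEquiv.symm_apply_eq]; exact (hg s).symm
    rw [e2, ← map_mul, ← e2]
    exact congrArg _ (Subtype.ext e)

theorem IsSubmoduleIsoQuotient.natCard_eq {ρ : R → Module.End F Ω} {V : AddSubgroup Ω} {I : Ideal R}
    (h : IsSubmoduleIsoQuotient ρ V I) : Nat.card V = Nat.card (R ⧸ I) :=
  let ⟨ψ, _⟩ := h
  Nat.card_congr ψ.toEquiv

end Cyclic

theorem natCard_quotient_span_singleton {E : Type*} [Field E] (f : E[X]) (hf : f ≠ 0) :
    Nat.card (E[X] ⧸ Ideal.span {f}) = Nat.card E ^ f.natDegree := by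
  have := (AdjoinRoot.powerBasis hf).finite
  rw [← finrank_quotient_span_eq_natDegree]
  have : Module.Finite E (E[X] ⧸ Ideal.span {f}) := this
  exact Module.natCard_eq_pow_finrank

/-! ### The action of a normalized Drinfeld module -/

section Action

variable {F : Type u} [Field F] [Fintype F] {L : Type u} [Field L] [Algebra F L] {j k : ℕ}

namespace NormalizedDrinfeldModule

variable (φ : NormalizedDrinfeldModule F L j k)

/-- `φ`, as a homomorphism to the endomorphisms of the algebraic closure. -/
def actHom : F[X] →ₐ[F] Module.End F (AlgebraicClosure L) :=
  (TwistedPolynomial F L).val.comp φ.toAlgHom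

theorem actHom_apply (a : F[X]) : φ.actHom a = φ.act a := rfl

theorem coe_actHom : (φ.actHom.toRingHom : F[X] → Module.End F (AlgebraicClosure L)) = φ.act := rfl

theorem act_mul (a b : F[X]) (v : AlgebraicClosure L) :
    φ.act (a * b) v = φ.act a (φ.act b v) := by
  simp [← actHom_apply]

theorem act_add (a b : F[X]) (v : AlgebraicClosure L) :
    φ.act (a + b) v = φ.act a v + φ.act b v := by
  simp [← actHom_apply]

theorem act_sub (a b : F[X]) (v : AlgebraicClosure L) :
    φ.act (a - b) v = φ.act a v - φ.act b v := by
  simp [← actHom_apply]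

theorem act_one (v : AlgebraicClosure L) : φ.act 1 v = v := by
  simp [← actHom_apply]

theorem act_zero (v : AlgebraicClosure L) : φ.act 0 v = 0 := by
  simp [← actHom_apply]

theorem act_C (c : F) (v : AlgebraicClosure L) : φ.act (C c) v = c • v := by
  rw [← actHom_apply, ← Polynomial.algebraMap_eq, AlgHom.commutes]
  simp [Module.algebraMap_end_apply]

theorem act_comm (a b : F[X]) (v : AlgebraicClosure L) :
    φ.act a (φ.act b v) = φ.act b (φ.act a v) := by
  rw [← act_mul, mul_comm, act_mul]

theorem tau_pow_apply (i : ℕ) (v : AlgebraicClosure L) :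
    (tau F L ^ i) v = v ^ Fintype.card F ^ i := by
  induction i generalizing v with
  | zero => simp
  | succ i ih =>
    rw [pow_succ, Module.End.mul_apply, ih]
    simp [tau, ← pow_mul, pow_succ']

theorem act_X (v : AlgebraicClosure L) :
    φ.act X v = -v ^ Fintype.card F ^ (j + k)
      + algebraMap L (AlgebraicClosure L) φ.g * v ^ Fintype.card F ^ j + v := by
  rw [act, φ.map_T]
  simp [scalar, tau_pow_apply]

-- A homomorphism out of F[T] is determined by the image of T, and here that image depends on g
-- alone.
@[ext]
theorem ext_g {φ ψ : NormalizedDrinfeldModule F L j k} (h : φ.g = ψ.g) : φ = ψ := by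
  have : φ.toAlgHom = ψ.toAlgHom := by
    ext1
    apply Subtype.ext
    rw [φ.map_T, ψ.map_T, h]
  cases φ
  cases ψ
  simp_all

theorem tau_mem : tau F L ∈ TwistedPolynomial F L :=
  Algebra.subset_adjoin (Set.mem_insert _ _)

theorem scalar_mem (c : L) : scalar F c ∈ TwistedPolynomial F L :=
  Algebra.subset_adjoin (Set.mem_insert_of_mem _ ⟨c, rfl⟩)

variable (F j k) in
/-- The normalized Drinfeld module with a given coefficient `g`. -/
def ofCoeff (g : L) : NormalizedDrinfeldModule F L j k where
  toAlgHom := aeval ⟨-(tau F L) ^ (j + k) + scalar F g * (tau F L) ^ j + 1,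
    add_mem (add_mem (neg_mem (pow_mem tau_mem _)) (mul_mem (scalar_mem g) (pow_mem tau_mem _)))
      (one_mem _)⟩
  g := g
  map_T := by simp

/-- `φ_a` commutes with `Aut(Lᵃˡᵍ / L)`. -/
theorem act_algEquiv (ξ : AlgebraicClosure L ≃ₐ[L] AlgebraicClosure L) (a : F[X])
    (v : AlgebraicClosure L) : φ.act a (ξ v) = ξ (φ.act a v) := by
  induction a using Polynomial.induction_on' generalizing v with
  | add p q hp hq => simp [act_add, hp, hq]
  | monomial n c =>
    rw [← C_mul_X_pow_eq_monomial]
    induction n generalizing v with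
    | zero =>
      rw [pow_zero, mul_one, act_C, act_C, Algebra.smul_def, Algebra.smul_def, map_mul,
        IsScalarTower.algebraMap_apply F L (AlgebraicClosure L), ξ.commutes]
    | succ n ih =>
      rw [pow_succ, ← mul_assoc, act_mul _ _ X, act_mul _ _ X, ← ih, act_X, act_X]
      simp

end NormalizedDrinfeldModule

end Action

/-! ### Polynomials that represent the action, and norms -/

section Norm

/-- The product of the values of `H` at the roots of a monic polynomial `P`. -/
theorem map_resultant_eq_prod {R S ι : Type*} [CommRing R] [CommRing S] (ψ : R →+* S) {P : R[X]}
    (hP : P.Monic) (H : R[X]) (s : Finset ι) (a : ι → S)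
    (h : P.map ψ = ∏ i ∈ s, (X - C (a i))) :
    ψ (resultant P H) = ∏ i ∈ s, (H.map ψ).eval (a i) := by
  nontriviality S
  have hdeg : P.natDegree = (∏ i ∈ s, (X - C (a i))).natDegree := by
    rw [← h, hP.natDegree_map]
  rw [← resultant_map_map, h, hdeg, resultant_prod_left]
  · refine Finset.prod_congr rfl fun i _ => ?_
    rw [natDegree_X_sub_C, resultant_X_sub_C_left _ _ _ natDegree_map_le]
  · simp
  · exact natDegree_map_le

end Norm

/-! ### Equations of finite subsets and the field containing their coefficients -/

section Equation

variable {L : Type u} [Field L]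

theorem equation_eq_prod {V : Set (AlgebraicClosure L)} (hV : V.Finite) :
    equation V = ∏ γ ∈ hV.toFinset, (X - C γ) := by
  rw [equation, finprod_mem_eq_finite_toFinset_prod _ hV]

theorem equation_coe (s : Finset (AlgebraicClosure L)) :
    equation (s : Set (AlgebraicClosure L)) = ∏ γ ∈ s, (X - C γ) :=
  finprod_mem_coe_finset _ _

theorem monic_equation {V : Set (AlgebraicClosure L)} (hV : V.Finite) : (equation V).Monic := by
  rw [equation_eq_prod hV]
  exact monic_prod_of_monic _ _ fun γ _ => monic_X_sub_C γ

theorem natDegree_equation {V : Set (AlgebraicClosure L)} (hV : V.Finite) :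
    (equation V).natDegree = V.ncard := by
  rw [equation_eq_prod hV, natDegree_prod_of_monic _ _ fun γ _ => monic_X_sub_C γ,
    Set.ncard_eq_toFinset_card V hV]
  simp

theorem eval_equation_eq_zero {V : Set (AlgebraicClosure L)} (hV : V.Finite)
    (y : AlgebraicClosure L) : (equation V).eval y = 0 ↔ y ∈ V := by
  rw [equation_eq_prod hV, eval_prod, Finset.prod_eq_zero_iff]
  simp [sub_eq_zero]

theorem equation_injOn {V W : Set (AlgebraicClosure L)} (hV : V.Finite) (hW : W.Finite)
    (h : equation V = equation W) : V = W := by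
  ext y
  rw [← eval_equation_eq_zero hV, h, eval_equation_eq_zero hW]

/-- A separable element outside L has a conjugate different from itself, and some automorphism
carries one to the other. Separability matters because L may be imperfect. -/
theorem mem_range_of_isSeparable_of_fixed {z : AlgebraicClosure L} (hz : IsSeparable L z)
    (h : ∀ ξ : AlgebraicClosure L ≃ₐ[L] AlgebraicClosure L, ξ z = z) :
    z ∈ Set.range (algebraMap L (AlgebraicClosure L)) := by
  by_contra hn
  obtain ⟨y, hy, hc⟩ := (notMem_iff_exists_ne_and_isConjRoot hz
    (IsAlgClosed.splits _)).1 (fun hb => hn (Algebra.mem_bot.1 hb))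
  obtain ⟨ξ, rfl⟩ := isConjRoot_iff_exists_algEquiv.1 hc
  exact hy (h ξ⁻¹ ▸ by simp)

/-- The coefficients lie in the separable closure because the roots do, and automorphisms fix them
because they permute the roots. -/
theorem equation_mem_lifts {V : Set (AlgebraicClosure L)} (hV : V.Finite)
    (hsep : ∀ γ ∈ V, IsSeparable L γ) (hG : IsGaloisStable V) :
    ∀ i, (equation V).coeff i ∈ Set.range (algebraMap L (AlgebraicClosure L)) := by
  intro i
  refine mem_range_of_isSeparable_of_fixed ?_ fun ξ => ?_
  · have : equation V ∈ lifts (separableClosure L (AlgebraicClosure L)).val.toRingHom := by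
      rw [equation_eq_prod hV]
      refine Subsemiring.prod_mem _ fun γ hγ => ?_
      refine ⟨X - C ⟨γ, hsep γ (hV.mem_toFinset.1 hγ)⟩, by simp⟩
    obtain ⟨y, hy⟩ := (lifts_iff_coeff_lifts _).1 this i
    rw [← hy]
    exact y.2
  · have : (equation V).map (ξ : AlgebraicClosure L →+* AlgebraicClosure L) = equation V := by
      classical
      conv_lhs => rw [equation_eq_prod hV]
      conv_rhs => rw [← hG ξ]
      rw [equation_eq_prod (hV.image ξ), Polynomial.map_prod, Set.Finite.toFinset_image,
        Finset.prod_image fun a _ b _ h => ξ.injective h]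
      · simp
      · exact hV
    conv_rhs => rw [← this]
    simp

end Equation

/-! ### The action as a polynomial in which g is an indeterminate -/

section ActPoly

variable (F : Type u) [Field F] [Fintype F] (j k : ℕ)

/-- `φ_T` as a polynomial, with `g` an indeterminate. -/
def actPolyX : F[X][X] :=
  -(X : F[X][X]) ^ Fintype.card F ^ (j + k) + C (X : F[X]) * X ^ Fintype.card F ^ j + X

variable {F} in
/-- `φ_a` as a polynomial, with `g` an indeterminate. -/
def actPoly (a : F[X]) : F[X][X] :=
  ∑ i ∈ a.support, C (C (a.coeff i)) * ((actPolyX F j k).comp)^[i] X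

variable {F j k}

/-- For j ≥ 1 both exponents q^j and q^{j+k} vanish in F, so only the linear term survives. -/
theorem derivative_actPolyX (hj : 1 ≤ j) : derivative (actPolyX F j k) = 1 := by
  have h : (Fintype.card F : F[X][X]) = 0 := by
    rw [← map_natCast (C.comp C : F →+* F[X][X]), Nat.cast_card_eq_zero, map_zero]
  simp [actPolyX, derivative_X_pow, h, show j ≠ 0 by omega]

theorem derivative_iterate_actPolyX (hj : 1 ≤ j) (i : ℕ) :
    derivative (((actPolyX F j k).comp)^[i] X) = 1 := by
  induction i with
  | zero => simp
  | succ i ih => rw [Function.iterate_succ_apply', derivative_comp, ih, derivative_actPolyX hj]; simp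

/-- By the chain rule every φ_{T^i} has derivative 1, so that of φ_a is the sum of the coefficients
of a. -/
theorem derivative_actPoly (hj : 1 ≤ j) (a : F[X]) :
    derivative (actPoly j k a) = C (C (a.eval 1)) := by
  simp only [actPoly, derivative_sum, derivative_C_mul, derivative_iterate_actPolyX hj]
  simp [eval_eq_sum, Polynomial.sum]

theorem coeff_zero_iterate_actPolyX (i : ℕ) :
    (((actPolyX F j k).comp)^[i] X).coeff 0 = 0 := by
  induction i with
  | zero => simp
  | succ i ih =>
    rw [coeff_zero_eq_eval_zero] at ih ⊢
    rw [Function.iterate_succ_apply', eval_comp, ih]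
    simp [actPolyX]

theorem coeff_zero_actPoly (a : F[X]) : (actPoly j k a).coeff 0 = 0 := by
  simp [actPoly, coeff_zero_iterate_actPolyX]

variable {L : Type u} [Field L] [Algebra F L] (φ : NormalizedDrinfeldModule F L j k)

theorem eval_map_iterate_actPolyX (i : ℕ) (v : AlgebraicClosure L) :
    ((((actPolyX F j k).comp)^[i] X).map
      (aeval (algebraMap L (AlgebraicClosure L) φ.g) : F[X] →ₐ[F] _).toRingHom).eval v =
      φ.act (X ^ i) v := by
  induction i with
  | zero => simp [φ.act_one]
  | succ i ih =>
    rw [Function.iterate_succ_apply', Polynomial.map_comp, eval_comp, ih, pow_succ', φ.act_mul,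
      φ.act_X]
    simp [actPolyX]

theorem eval_map_actPoly (a : F[X]) (v : AlgebraicClosure L) :
    ((actPoly j k a).map
      (aeval (algebraMap L (AlgebraicClosure L) φ.g) : F[X] →ₐ[F] _).toRingHom).eval v =
      φ.act a v := by
  simp only [actPoly, Polynomial.map_sum, Polynomial.map_mul, eval_finsetSum, eval_mul,
    eval_map_iterate_actPolyX]
  conv_rhs => rw [a.as_sum_support_C_mul_X_pow]
  rw [← φ.actHom_apply, map_sum, LinearMap.sum_apply]
  refine Finset.sum_congr rfl fun i _ => ?_
  rw [φ.actHom_apply, φ.act_mul, φ.act_C, Algebra.smul_def]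
  simp

/-- The points killed by `φ_a` are separable if `a(1) ≠ 0`. -/
theorem isSeparable_of_act_eq_zero (hj : 1 ≤ j) {a : F[X]} (ha : a.eval 1 ≠ 0)
    {v : AlgebraicClosure L} (hv : φ.act a v = 0) : IsSeparable L v := by
  let H : L[X] := (actPoly j k a).map (aeval φ.g : F[X] →ₐ[F] L).toRingHom
  have hH : H.Separable := by
    have : derivative H = C (algebraMap F L (a.eval 1)) := by
      simp [H, derivative_map, derivative_actPoly hj]
    rw [Polynomial.Separable, this]
    exact isCoprime_one_right.of_isCoprime_of_dvd_right
      ((isUnit_C.2 ((_root_.map_ne_zero _).2 ha).isUnit).dvd)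
  refine hH.of_dvd (minpoly.dvd _ _ ?_)
  rw [aeval_def, ← Polynomial.eval_map, Polynomial.map_map, ← hv, ← eval_map_actPoly]
  congr 2
  ext <;> simp [← IsScalarTower.algebraMap_apply]

end ActPoly

/-! ### The polynomials `F(T)` and `f(T)` -/

section BigF

variable (F : Type u) [Field F] {k : ℕ}

theorem bigF_eq_X_mul_smallF (k : ℕ) : bigF F k = X * smallF F k := by
  have h : (1 - X : F[X]) ^ k = ∑ i ∈ Finset.range (k + 1), (-X) ^ i * (k.choose i : F[X]) := by
    rw [sub_eq_neg_add, add_pow]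
    simp
  rw [bigF, h, Finset.sum_range_succ', smallF, Finset.mul_sum]
  have h2 : Finset.Icc 1 k = (Finset.range k).image (· + 1) := by
    ext i
    simp only [Finset.mem_Icc, Finset.mem_image, Finset.mem_range]
    exact ⟨fun hi => ⟨i - 1, by omega⟩, by rintro ⟨a, ha, rfl⟩; omega⟩
  rw [h2, Finset.sum_image fun a _ b _ h => by simpa using h]
  simp only [pow_zero, Nat.choose_zero_right, Nat.cast_one, mul_one, sub_add_cancel_right,
    ← Finset.sum_neg_distrib]
  refine Finset.sum_congr rfl fun i _ => ?_
  rw [Nat.add_sub_cancel, pow_succ]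
  ring

/-- The hypothesis `(k : F) ≠ 0` acts through this constant term: it makes f(T) prime to T and
invertible modulo T^n. -/
theorem eval_zero_smallF (hk : 1 ≤ k) : (smallF F k).eval 0 = k := by
  rw [smallF, eval_finsetSum, Finset.sum_eq_single 1]
  · simp
  · intro i hi h1
    have : i - 1 ≠ 0 := by have := (Finset.mem_Icc.1 hi).1; omega
    simp [this]
  · intro h
    exact absurd (Finset.mem_Icc.2 ⟨le_rfl, hk⟩) h

theorem eval_one_bigF (hk : 1 ≤ k) : (bigF F k).eval 1 = 1 := by
  simp [bigF, show k ≠ 0 by omega]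

/-- Through `derivative_actPoly`, this makes the linear coefficient of φ_{f(T)^n} equal to 1. -/
theorem eval_one_smallF (hk : 1 ≤ k) : (smallF F k).eval 1 = 1 := by
  have := eval_one_bigF F hk
  rwa [bigF_eq_X_mul_smallF, eval_mul, eval_X, one_mul] at this

theorem natDegree_bigF (hk : 1 ≤ k) : (bigF F k).natDegree = k := by
  have h : ((1 - X : F[X]) ^ k).natDegree = k := by
    rw [natDegree_pow, ← neg_sub, natDegree_neg, ← C_1, natDegree_X_sub_C, mul_one]
  rw [bigF, natDegree_sub_eq_right_of_natDegree_lt] <;> simp [h]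
  omega

theorem bigF_ne_zero (hk : 1 ≤ k) : bigF F k ≠ 0 := fun h => by
  have := eval_one_bigF F hk
  simp [h] at this

theorem smallF_ne_zero (hk : 1 ≤ k) : smallF F k ≠ 0 := fun h => by
  have := eval_one_smallF F hk
  simp [h] at this

variable {F}

theorem isCoprime_X_pow_of_eval_ne_zero {E : Type*} [Field E] {f : E[X]} (hf : f.eval 0 ≠ 0)
    (a : ℕ) : IsCoprime (X ^ a) f := by
  refine IsCoprime.pow_left ((irreducible_X.coprime_iff_not_dvd).2 fun h => hf ?_)
  rw [← coeff_zero_eq_eval_zero]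
  exact X_dvd_iff.1 h

theorem isCoprime_X_pow_smallF_pow (hk : 1 ≤ k) (hp : (k : F) ≠ 0) (a b : ℕ) :
    IsCoprime (X ^ a) (smallF F k ^ b) :=
  isCoprime_X_pow_of_eval_ne_zero (by simp [eval_zero_smallF F hk, hp]) a

/-- `F(T)` generates `A / T ^ n A` as an `F`-algebra. -/
theorem exists_X_pow_dvd_sub_comp_bigF (hk : 1 ≤ k) (hp : (k : F) ≠ 0) (a : F[X]) (n : ℕ) :
    ∃ b : F[X], X ^ n ∣ a - b.comp (bigF F k) := by
  induction n with
  | zero => exact ⟨0, by simp⟩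
  | succ n ih =>
    obtain ⟨b, c, hc⟩ := ih
    -- F(T)^n = T^n f(T)^n has leading term k^n T^n at 0, so this multiple cancels the lowest term
    -- of the error T^n c.
    refine ⟨b + C (c.eval 0 / k ^ n) * X ^ n, ?_⟩
    have : X ∣ c - C (c.eval 0 / k ^ n) * smallF F k ^ n := by
      rw [X_dvd_iff, coeff_zero_eq_eval_zero]
      simp [eval_zero_smallF F hk, hp]
    obtain ⟨d, hd⟩ := this
    refine ⟨d, ?_⟩
    rw [add_comp, mul_comp, C_comp, X_pow_comp, ← sub_sub, hc, bigF_eq_X_mul_smallF, mul_pow,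
      pow_succ, mul_assoc, ← hd]
    ring

end BigF

/-! ### The field `𝔽_{q^k}` -/

section Fqk

variable {F : Type u} [Field F] [Fintype F] {L : Type u} [Field L] [Algebra F L] {j k : ℕ}

theorem mem_fqk {μ : AlgebraicClosure L} :
    μ ∈ fqk F L k ↔ μ ^ Fintype.card F ^ k = μ := by
  have h : ∀ i, ((FiniteField.frobeniusAlgHom F (AlgebraicClosure L)) ^ i) μ =
      μ ^ Fintype.card F ^ i := fun i => by
    induction i with
    | zero => simp
    | succ i ih =>
      rw [pow_succ', AlgHom.mul_apply, ih]
      simp [← pow_mul, pow_succ]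
  rw [← h]
  rfl

theorem algebraMap_mem_fqk (c : F) : algebraMap F (AlgebraicClosure L) c ∈ fqk F L k := by
  rw [mem_fqk, ← map_pow, FiniteField.pow_card_pow]

theorem algEquiv_mem_fqk (ξ : AlgebraicClosure L ≃ₐ[L] AlgebraicClosure L)
    {μ : AlgebraicClosure L} (hμ : μ ∈ fqk F L k) : ξ μ ∈ fqk F L k := by
  rw [mem_fqk] at *
  rw [← map_pow, hμ]

theorem finite_fqk_and_ncard_le (hk : 1 ≤ k) : (fqk F L k : Set (AlgebraicClosure L)).Finite ∧
    (fqk F L k : Set (AlgebraicClosure L)).ncard ≤ Fintype.card F ^ k := by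
  classical
  have hq : 1 < Fintype.card F ^ k := Nat.one_lt_pow (by omega) Fintype.one_lt_card
  have hne := FiniteField.X_pow_card_sub_X_ne_zero (AlgebraicClosure L) hq
  have hsub : (fqk F L k : Set (AlgebraicClosure L)) ⊆
      (X ^ (Fintype.card F ^ k) - X : (AlgebraicClosure L)[X]).roots.toFinset := fun μ hμ => by
    simpa [hne, sub_eq_zero] using mem_fqk.1 hμ
  refine ⟨(Finset.finite_toSet _).subset hsub,
    (Set.ncard_le_ncard hsub (Finset.finite_toSet _)).trans ?_⟩
  rw [Set.ncard_coe_finset]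
  exact (Multiset.toFinset_card_le _).trans ((card_roots' _).trans
    (FiniteField.X_pow_card_sub_X_natDegree_eq _ hq).le)

variable (F) in
theorem exists_extension_finrank (hk : 1 ≤ k) : ∃ (Λ : Type) (_ : Field Λ) (_ : Algebra F Λ),
    FiniteDimensional F Λ ∧ Module.finrank F Λ = k := by
  have : Fact (ringChar F).Prime := ⟨CharP.char_is_prime F _⟩
  have : NeZero k := ⟨by omega⟩
  exact ⟨FiniteField.Extension F (ringChar F) k, inferInstance, inferInstance, inferInstance,
    FiniteField.finrank_extension F (ringChar F) k⟩

variable {Λ : Type*} [Field Λ] [Algebra F Λ] [FiniteDimensional F Λ]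

/-- The q^k values of σ satisfy y^{q^k} = y, an equation with at most q^k solutions. -/
theorem range_eq_fqk (hk : 1 ≤ k) (hΛ : Module.finrank F Λ = k)
    (σ : Λ →ₐ[F] AlgebraicClosure L) : Set.range σ = fqk F L k := by
  have : Finite Λ := Module.finite_of_finite F
  have := Fintype.ofFinite Λ
  have hc : Fintype.card Λ = Fintype.card F ^ k := by
    rw [← hΛ]; exact Module.card_eq_pow_finrank
  obtain ⟨h1, h2⟩ := finite_fqk_and_ncard_le (F := F) (L := L) hk
  refine Set.eq_of_subset_of_ncard_le ?_ ?_ h1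
  · rintro _ ⟨x, rfl⟩
    rw [SetLike.mem_coe, mem_fqk, ← map_pow, ← hc, FiniteField.pow_card]
  · have hinj : Function.Injective σ := σ.injective
    rw [← Set.image_univ, Set.ncard_image_of_injective _ hinj, Set.ncard_univ,
      Nat.card_eq_fintype_card, hc]
    exact h2

theorem natCard_fqk (hk : 1 ≤ k) : Nat.card (fqk F L k) = Fintype.card F ^ k := by
  obtain ⟨Λ, _, _, _, hΛ⟩ := exists_extension_finrank F hk
  have : Finite Λ := Module.finite_of_finite F
  have := Fintype.ofFinite Λ
  let σ : Λ →ₐ[F] AlgebraicClosure L := IsAlgClosed.lift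
  have h : Nat.card (Set.range σ) = Nat.card Λ := Nat.card_range_of_injective σ.injective
  rw [range_eq_fqk hk hΛ] at h
  refine h.trans ?_
  rw [Nat.card_eq_fintype_card, Module.card_eq_pow_finrank (K := F) (V := Λ), hΛ]

/-- The conjugates of some element of `𝔽_{q^k}` under the `q ^ j`-Frobenius span it over `F`. -/
theorem exists_normal (hk : 1 ≤ k) (hjk : j.Coprime k) : ∃ l ∈ fqk F L k,
    ∀ (N : Submodule F (AlgebraicClosure L)) (v : AlgebraicClosure L),
      (∀ s, l ^ Fintype.card F ^ (j * s) * v ∈ N) → ∀ μ ∈ fqk F L k, μ * v ∈ N := by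
  obtain ⟨Λ, _, _, _, hΛ⟩ := exists_extension_finrank F hk
  have : Finite Λ := Module.finite_of_finite F
  let σ : Λ →ₐ[F] AlgebraicClosure L := IsAlgClosed.lift
  have hr := range_eq_fqk hk hΛ σ
  let b := IsGalois.normalBasis F Λ
  let fr := FiniteField.frobeniusAlgEquivOfAlgebraic F Λ
  have hfr : ∀ (i : ℕ) (x : Λ), (fr ^ i) x = x ^ Fintype.card F ^ i := fun i x => by
    rw [AlgEquiv.coe_pow, FiniteField.coe_frobeniusAlgEquivOfAlgebraic_iterate]
  refine ⟨σ (b 1), hr.subset ⟨_, rfl⟩, fun N v h μ hμ => ?_⟩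
  rw [← SetLike.mem_coe, ← hr] at hμ
  obtain ⟨x, rfl⟩ := hμ
  rw [← b.sum_repr x, map_sum, Finset.sum_mul]
  refine N.sum_mem fun e _ => ?_
  rw [map_smul, smul_mul_assoc]
  refine N.smul_mem _ ?_
  obtain ⟨i, hi⟩ := (FiniteField.bijective_frobeniusAlgEquivOfAlgebraic_pow F Λ).2 e
  -- The Galois group is cyclic of order k, generated by the q-Frobenius. As j is prime to k, the
  -- q^j-Frobenius generates it too, so its powers reach every member of the normal basis.
  obtain ⟨m, hm⟩ := exists_pow_eq_self_of_coprime (x := fr) (n := j) (by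
    rw [FiniteField.orderOf_frobeniusAlgEquivOfAlgebraic, hΛ]; exact hjk)
  have he : e = fr ^ (j * (m * i)) := by
    rw [pow_mul, pow_mul, hm]; exact hi.symm
  have : b e = b 1 ^ Fintype.card F ^ (j * (m * i)) := by
    rw [← hfr, ← he]; exact IsGalois.normalBasis_apply e
  rw [this, map_pow]
  exact h _

end Fqk

/-! ### The correspondence between level structures -/

section Correspondence

variable {F : Type u} [Field F] [Fintype F] {L : Type u} [Field L] [Algebra F L] {j k n : ℕ}

theorem isGaloisStable_of_forall {V : Set (AlgebraicClosure L)}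
    (h : ∀ (ξ : AlgebraicClosure L ≃ₐ[L] AlgebraicClosure L), ∀ v ∈ V, ξ v ∈ V) :
    IsGaloisStable V := fun ξ => by
  refine (Set.image_subset_iff.2 (h ξ)).antisymm fun v hv => ⟨ξ.symm v, h _ v hv, by simp⟩

theorem IsGaloisStable.apply_mem {V : Set (AlgebraicClosure L)} (h : IsGaloisStable V)
    (ξ : AlgebraicClosure L ≃ₐ[L] AlgebraicClosure L) {v : AlgebraicClosure L} (hv : v ∈ V) :
    ξ v ∈ V :=
  (h ξ).subset ⟨v, hv, rfl⟩

theorem pow_card_pow_mul_of_mem_fqk {μ : AlgebraicClosure L} (hμ : μ ∈ fqk F L k) (i : ℕ) :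
    μ ^ Fintype.card F ^ (i * k) = μ := by
  induction i with
  | zero => simp
  | succ i ih => rw [Nat.succ_mul, pow_add, pow_mul, ih, mem_fqk.1 hμ]

namespace NormalizedDrinfeldModule

variable (φ : NormalizedDrinfeldModule F L j k)

/-- The `A`-submodule generated by `v`. -/
def orbit (v : AlgebraicClosure L) : Submodule F (AlgebraicClosure L) :=
  LinearMap.range ((LinearMap.applyₗ v).comp φ.actHom.toLinearMap)

variable {φ}

theorem act_mem_orbit {v w : AlgebraicClosure L} (a : F[X]) (hw : w ∈ φ.orbit v) :
    φ.act a w ∈ φ.orbit v := by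
  obtain ⟨b, rfl⟩ := hw
  exact ⟨a * b, φ.act_mul a b v⟩

-- φ_{1-T} = τ^{j+k} - gτ^j has no constant term, and τ^{j+k} and τ^j agree on 𝔽_{q^k}; both terms
-- twist the scalar in the same way.
variable (φ) in
theorem act_pow_one_sub_X_mul {μ : AlgebraicClosure L} (hμ : μ ∈ fqk F L k) (s : ℕ)
    (v : AlgebraicClosure L) :
    φ.act ((1 - X) ^ s) (μ * v) = μ ^ Fintype.card F ^ (j * s) * φ.act ((1 - X) ^ s) v := by
  have hone : ∀ ν ∈ fqk F L k, ∀ v,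
      φ.act (1 - X) (ν * v) = ν ^ Fintype.card F ^ j * φ.act (1 - X) v := fun ν hν v => by
    have : ν ^ Fintype.card F ^ (j + k) = ν ^ Fintype.card F ^ j := by
      rw [add_comm, pow_add, pow_mul, mem_fqk.1 hν]
    rw [act_sub, act_sub, act_one, act_one, act_X, act_X, mul_pow, mul_pow, this]
    ring
  induction s with
  | zero => simp [act_one]
  | succ s ih =>
    rw [pow_succ', act_mul, act_mul, ih, hone _ (pow_mem hμ _), ← pow_mul, ← pow_add]
    rfl

/-- The k-th power of 1-T twists scalars by the q^{jk}-Frobenius, which is trivial on 𝔽_{q^k}. -/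
theorem act_bigF_mul {μ : AlgebraicClosure L} (hμ : μ ∈ fqk F L k) (v : AlgebraicClosure L) :
    φ.act (bigF F k) (μ * v) = μ * φ.act (bigF F k) v := by
  rw [bigF, act_sub, act_sub, act_one, act_one, act_pow_one_sub_X_mul φ hμ,
    pow_card_pow_mul_of_mem_fqk hμ, mul_sub]

theorem act_bigF_pow_mul {μ : AlgebraicClosure L} (hμ : μ ∈ fqk F L k) (i : ℕ)
    (v : AlgebraicClosure L) :
    φ.act (bigF F k ^ i) (μ * v) = μ * φ.act (bigF F k ^ i) v := by
  induction i with
  | zero => simp [act_one]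
  | succ i ih => rw [pow_succ', act_mul, ih, act_bigF_mul hμ, act_mul]

theorem act_comp_bigF_mul {μ : AlgebraicClosure L} (hμ : μ ∈ fqk F L k) (b : F[X])
    (v : AlgebraicClosure L) :
    φ.act (b.comp (bigF F k)) (μ * v) = μ * φ.act (b.comp (bigF F k)) v := by
  induction b using Polynomial.induction_on' with
  | add p q hp hq => rw [add_comp, act_add, act_add, hp, hq, mul_add]
  | monomial i c =>
    rw [monomial_comp, act_mul, act_bigF_pow_mul hμ, act_mul, act_C, act_C, mul_smul_comm]

variable (φ) in
/-- The action of `A_k`, as a ring homomorphism. -/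
def actKHom : (fqk F L k)[X] →+* Module.End F (AlgebraicClosure L) :=
  eval₂RingHom' ((Algebra.lmul F (AlgebraicClosure L)).toRingHom.comp (fqk F L k).subtype)
    (φ.bigAct X) fun μ => LinearMap.ext fun v => by
      simp only [bigAct, X_comp]
      exact (act_bigF_mul μ.2 v).symm

theorem coe_actKHom : (φ.actKHom : _ → Module.End F (AlgebraicClosure L)) = φ.actK := rfl

theorem actK_C (μ : fqk F L k) (v : AlgebraicClosure L) : φ.actK (C μ) v = μ * v := by
  simp [actK]

theorem actK_X_pow (i : ℕ) (v : AlgebraicClosure L) :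
    φ.actK (X ^ i) v = φ.act (bigF F k ^ i) v := by
  rw [← coe_actKHom, map_pow, coe_actKHom]
  simp [actK, bigAct, ← actHom_apply]

theorem actK_mul (r s : (fqk F L k)[X]) (v : AlgebraicClosure L) :
    φ.actK (r * s) v = φ.actK r (φ.actK s v) := by
  simp [← coe_actKHom]

theorem actK_add (r s : (fqk F L k)[X]) (v : AlgebraicClosure L) :
    φ.actK (r + s) v = φ.actK r v + φ.actK s v := by
  simp [← coe_actKHom]

-- The witness is b itself, with its coefficients read in 𝔽_{q^k}.
variable (φ) in
theorem exists_actK_eq_comp_bigF (b : F[X]) :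
    ∃ r : (fqk F L k)[X], ∀ v, φ.actK r v = φ.act (b.comp (bigF F k)) v := by
  induction b using Polynomial.induction_on' with
  | add p q hp hq =>
    obtain ⟨r, hr⟩ := hp
    obtain ⟨s, hs⟩ := hq
    exact ⟨r + s, fun v => by rw [actK_add, hr, hs, add_comp, act_add]⟩
  | monomial i c =>
    refine ⟨C ⟨_, algebraMap_mem_fqk c⟩ * X ^ i, fun v => ?_⟩
    rw [actK_mul, actK_C, actK_X_pow, monomial_comp, act_mul, act_C, Algebra.smul_def]

variable (φ) in
/-- The `A_k`-submodule generated by `v`. -/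
def orbitK (v : AlgebraicClosure L) : Submodule (fqk F L k) (AlgebraicClosure L) where
  carrier := {w | ∃ r, φ.actK r v = w}
  zero_mem' := ⟨0, by simp [← coe_actKHom]⟩
  add_mem' := by
    rintro _ _ ⟨r, rfl⟩ ⟨s, rfl⟩
    exact ⟨r + s, actK_add r s v⟩
  smul_mem' := by
    rintro μ _ ⟨r, rfl⟩
    exact ⟨C μ * r, by rw [actK_mul, actK_C]; rfl⟩

/-- Containment in the kernel of φ_{T^n} follows from the annihilator of the generator. -/
theorem mem_levelX_iff {G : Submodule F (AlgebraicClosure L)} :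
    G ∈ levelX φ (X ^ n) ↔
      (∃ v, G = φ.orbit v ∧ ∀ a, φ.act a v = 0 ↔ X ^ n ∣ a) ∧
        IsGaloisStable (G : Set (AlgebraicClosure L)) := by
  have h := isSubmoduleIsoQuotient_iff φ.actHom.toRingHom G.toAddSubgroup (Ideal.span {X ^ n})
  rw [coe_actHom] at h
  constructor
  · rintro ⟨-, hc, hs⟩
    obtain ⟨v, hv, hI⟩ := h.1 hc
    exact ⟨⟨v, SetLike.ext fun w => hv w, fun a => (hI a).trans Ideal.mem_span_singleton⟩, hs⟩
  · rintro ⟨⟨v, rfl, hI⟩, hs⟩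
    refine ⟨?_, h.2 ⟨v, fun w => Iff.rfl, fun a => (hI a).trans Ideal.mem_span_singleton.symm⟩, hs⟩
    rintro _ ⟨a, rfl⟩
    change φ.act (X ^ n) (φ.act a v) = 0
    rw [← act_mul, hI]
    exact dvd_mul_right _ _

/-- The generators over A and over A_k are chosen independently of each other. -/
theorem mem_levelM_iff {E : Submodule (fqk F L k) (AlgebraicClosure L)} :
    E ∈ levelM φ n ↔
      (∃ w, (E : Set (AlgebraicClosure L)) = φ.orbit w ∧ ∀ a, φ.act a w = 0 ↔ bigF F k ^ n ∣ a) ∧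
      (∃ v, E = φ.orbitK v ∧ ∀ r, φ.actK r v = 0 ↔ X ^ n ∣ r) ∧
        IsGaloisStable (E : Set (AlgebraicClosure L)) := by
  have h := isSubmoduleIsoQuotient_iff φ.actHom.toRingHom E.toAddSubgroup
    (Ideal.span {bigF F k ^ n})
  rw [coe_actHom] at h
  have h' := isSubmoduleIsoQuotient_iff φ.actKHom E.toAddSubgroup
    (Ideal.span {(X : (fqk F L k)[X]) ^ n})
  rw [coe_actKHom] at h'
  constructor
  · rintro ⟨-, hs, hc, hc'⟩
    obtain ⟨w, hw, hI⟩ := h.1 hc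
    obtain ⟨v, hv, hI'⟩ := h'.1 hc'
    exact ⟨⟨w, Set.ext fun w => hw w, fun a => (hI a).trans Ideal.mem_span_singleton⟩,
      ⟨v, SetLike.ext fun w => hv w, fun a => (hI' a).trans Ideal.mem_span_singleton⟩, hs⟩
  · rintro ⟨⟨w, hw, hI⟩, ⟨v, hv, hI'⟩, hs⟩
    refine ⟨fun x hx => ?_, hs,
      h.2 ⟨w, fun x => Set.ext_iff.1 hw x, fun a => (hI a).trans Ideal.mem_span_singleton.symm⟩,
      h'.2 ⟨v, fun x => SetLike.ext_iff.1 hv x,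
        fun a => (hI' a).trans Ideal.mem_span_singleton.symm⟩⟩
    obtain ⟨a, rfl⟩ := hw.subset hx
    change φ.act ((X ^ n).comp (bigF F k)) (φ.act a w) = 0
    rw [← act_mul, hI, X_pow_comp]
    exact dvd_mul_right _ _

theorem natCard_of_mem_levelX {G : Submodule F (AlgebraicClosure L)} (hG : G ∈ levelX φ (X ^ n)) :
    (G : Set (AlgebraicClosure L)).ncard = Fintype.card F ^ n := by
  have := hG.2.1.natCard_eq
  rw [natCard_quotient_span_singleton _ (pow_ne_zero _ X_ne_zero), natDegree_X_pow,
    Nat.card_eq_fintype_card (α := F)] at this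
  exact this

theorem natCard_of_mem_levelM (hk : 1 ≤ k) {E : Submodule (fqk F L k) (AlgebraicClosure L)}
    (hE : E ∈ levelM φ n) : (E : Set (AlgebraicClosure L)).ncard = Fintype.card F ^ (k * n) := by
  have := hE.2.2.1.natCard_eq
  rw [natCard_quotient_span_singleton _ (pow_ne_zero _ (bigF_ne_zero F hk)), natDegree_pow,
    natDegree_bigF F hk, Nat.card_eq_fintype_card (α := F), mul_comm] at this
  exact this

theorem finite_of_mem_levelX {G : Submodule F (AlgebraicClosure L)} (hG : G ∈ levelX φ (X ^ n)) :
    (G : Set (AlgebraicClosure L)).Finite :=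
  Set.finite_of_ncard_ne_zero (by
    rw [natCard_of_mem_levelX hG]; exact pow_ne_zero _ Fintype.card_ne_zero)

theorem finite_of_mem_levelM (hk : 1 ≤ k) {E : Submodule (fqk F L k) (AlgebraicClosure L)}
    (hE : E ∈ levelM φ n) : (E : Set (AlgebraicClosure L)).Finite :=
  Set.finite_of_ncard_ne_zero (by
    rw [natCard_of_mem_levelM hk hE]; exact pow_ne_zero _ Fintype.card_ne_zero)

/-- The generator over `A_k` of the span of a cyclic `A`-module. -/
theorem span_orbit_eq (hk : 1 ≤ k) (hp : (k : F) ≠ 0) {v : AlgebraicClosure L}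
    (hv : ∀ a, φ.act a v = 0 ↔ X ^ n ∣ a) :
    Submodule.span (fqk F L k) (φ.orbit v : Set (AlgebraicClosure L)) = φ.orbitK v := by
  refine le_antisymm (Submodule.span_le.2 ?_) ?_
  · rintro _ ⟨a, rfl⟩
    -- On v only the class of a modulo T^n matters, and that class is a polynomial in F(T), whose
    -- action belongs to A_k.
    obtain ⟨b, hb⟩ := exists_X_pow_dvd_sub_comp_bigF hk hp a n
    obtain ⟨r, hr⟩ := φ.exists_actK_eq_comp_bigF b
    refine ⟨r, ?_⟩
    rw [hr, eq_comm, ← sub_eq_zero]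
    exact (φ.act_sub _ _ _).symm.trans ((hv _).2 hb)
  · rintro _ ⟨r, rfl⟩
    induction r using Polynomial.induction_on' with
    | add p q hp hq => rw [actK_add]; exact add_mem hp hq
    | monomial i μ =>
      rw [← C_mul_X_pow_eq_monomial, actK_mul, actK_C, actK_X_pow]
      exact Submodule.smul_mem _ μ (Submodule.subset_span ⟨_, rfl⟩)

/-- Modulo T^n a nonzero r is a unit times some T^i, so it suffices to know which powers of Φ_T kill
v. There T^n must divide T^i f(T)^i, and f(T) is prime to T. -/
theorem actK_eq_zero_iff (hk : 1 ≤ k) (hp : (k : F) ≠ 0) {v : AlgebraicClosure L}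
    (hv : ∀ a, φ.act a v = 0 ↔ X ^ n ∣ a) (r : (fqk F L k)[X]) :
    φ.actK r v = 0 ↔ X ^ n ∣ r := by
  have hX : ∀ i, φ.actK (X ^ i) v = 0 ↔ n ≤ i := fun i => by
    rw [actK_X_pow, hv, bigF_eq_X_mul_smallF, mul_pow]
    refine ⟨fun h => ?_, fun h => (pow_dvd_pow X h).trans (dvd_mul_right _ _)⟩
    exact (pow_dvd_pow_iff X_ne_zero not_isUnit_X).1
      ((isCoprime_X_pow_smallF_pow hk hp n i).dvd_of_dvd_mul_right h)
  constructor
  · intro h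
    rcases eq_or_ne r 0 with rfl | hr
    · exact dvd_zero _
    obtain ⟨s, hs, hd⟩ := exists_eq_pow_rootMultiplicity_mul_and_not_dvd r hr 0
    rw [C_0, sub_zero] at hs hd
    set i := rootMultiplicity 0 r
    have hs0 : s.eval 0 ≠ 0 := fun h0 => hd (X_dvd_iff.2 (by rwa [coeff_zero_eq_eval_zero]))
    obtain ⟨a, b, e⟩ := isCoprime_X_pow_of_eval_ne_zero hs0 n
    have hi : n ≤ i := by
      rw [← hX]
      have : (X : (fqk F L k)[X]) ^ i = (a * X ^ i) * X ^ n + b * r := by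
        calc _ = X ^ i * (a * X ^ n + b * s) := by rw [e, mul_one]
          _ = _ := by rw [hs]; ring
      rw [this, actK_add, actK_mul, (hX n).2 le_rfl, actK_mul b r, h, map_zero, map_zero,
        add_zero]
    rw [hs]
    exact (pow_dvd_pow X hi).trans (dvd_mul_right _ _)
  · rintro ⟨s, rfl⟩
    rw [mul_comm, actK_mul, (hX n).2 le_rfl, map_zero]

variable (φ) in
theorem natCard_orbitK {v : AlgebraicClosure L} (hk : 1 ≤ k)
    (hv : ∀ r, φ.actK r v = 0 ↔ X ^ n ∣ r) :
    (φ.orbitK v : Set (AlgebraicClosure L)).ncard = Fintype.card F ^ (k * n) := by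
  have h := (isSubmoduleIsoQuotient_iff φ.actKHom (φ.orbitK v).toAddSubgroup
    (Ideal.span {(X : (fqk F L k)[X]) ^ n})).2
      ⟨v, fun w => Iff.rfl, fun r => (hv r).trans Ideal.mem_span_singleton.symm⟩
  have := h.natCard_eq
  rw [natCard_quotient_span_singleton _ (pow_ne_zero _ X_ne_zero), natDegree_X_pow,
    natCard_fqk hk, ← pow_mul] at this
  exact this

/-- The orbit is a quotient of A/F(T)^nA with the same finite number of elements, so the quotient
map is injective. -/
theorem bigF_pow_dvd_of_natCard (hk : 1 ≤ k) {w : AlgebraicClosure L}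
    (h0 : φ.act (bigF F k ^ n) w = 0)
    (hc : (φ.orbit w : Set (AlgebraicClosure L)).ncard = Fintype.card F ^ (k * n)) (a : F[X]) :
    φ.act a w = 0 ↔ bigF F k ^ n ∣ a := by
  let g : (F[X] ⧸ Ideal.span {bigF F k ^ n}) → φ.orbit w :=
    Quotient.lift (fun a => ⟨φ.act a w, a, rfl⟩) fun a b hab => by
      have : a - b ∈ Ideal.span {bigF F k ^ n} :=
        (Submodule.quotientRel_def _).1 hab
      obtain ⟨c, hc⟩ := Ideal.mem_span_singleton.1 this
      refine Subtype.ext (sub_eq_zero.1 ?_)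
      rw [← act_sub, hc, mul_comm, act_mul, h0, map_zero]
  have hg : Function.Surjective g := by
    rintro ⟨_, a, rfl⟩
    exact ⟨Ideal.Quotient.mk _ a, rfl⟩
  have hcard : Nat.card (F[X] ⧸ Ideal.span {bigF F k ^ n}) = Fintype.card F ^ (k * n) := by
    rw [natCard_quotient_span_singleton _ (pow_ne_zero _ (bigF_ne_zero F hk)), natDegree_pow,
      natDegree_bigF F hk, Nat.card_eq_fintype_card, mul_comm]
  have hpos : Fintype.card F ^ (k * n) ≠ 0 := pow_ne_zero _ Fintype.card_ne_zero
  have : Finite (F[X] ⧸ Ideal.span {bigF F k ^ n}) := Nat.finite_of_card_ne_zero (hcard ▸ hpos)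
  have hinj : Function.Injective g :=
    (hg.bijective_of_nat_card_le (hcard.le.trans hc.symm.le)).1
  constructor
  · intro ha
    have : g (Ideal.Quotient.mk _ a) = g (Ideal.Quotient.mk _ 0) :=
      Subtype.ext (ha.trans (φ.act_zero w).symm)
    have := hinj this
    rw [map_zero, Ideal.Quotient.eq_zero_iff_mem] at this
    exact Ideal.mem_span_singleton.1 this
  · rintro ⟨c, rfl⟩
    rw [mul_comm, act_mul, h0, map_zero]

/-- Although φ_T is not 𝔽_{q^k}-linear, φ_{1-T} is semilinear and so preserves the span; T = 1 - (1
- T) then does as well. -/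
theorem act_mem_span_orbit {v w : AlgebraicClosure L} (a : F[X])
    (hw : w ∈ Submodule.span (fqk F L k) (φ.orbit v : Set (AlgebraicClosure L))) :
    φ.act a w ∈ Submodule.span (fqk F L k) (φ.orbit v : Set (AlgebraicClosure L)) := by
  have hX : ∀ w ∈ Submodule.span (fqk F L k) (φ.orbit v : Set (AlgebraicClosure L)),
      φ.act (1 - X) w ∈ Submodule.span (fqk F L k) (φ.orbit v : Set (AlgebraicClosure L)) := by
    intro w hw
    induction hw using Submodule.span_induction with
    | mem x hx => exact Submodule.subset_span (act_mem_orbit _ hx)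
    | zero => rw [map_zero]; exact zero_mem _
    | add x y _ _ hx hy => rw [map_add]; exact add_mem hx hy
    | smul μ x _ hx =>
      have := φ.act_pow_one_sub_X_mul μ.2 1 x
      rw [pow_one, mul_one] at this
      rw [Subfield.smul_def, smul_eq_mul, this]
      exact Submodule.smul_mem _ (μ ^ Fintype.card F ^ j) hx
  induction a using Polynomial.induction_on' with
  | add p q hp hq => rw [act_add]; exact add_mem hp hq
  | monomial i c =>
    rw [← C_mul_X_pow_eq_monomial, act_mul, act_C, Algebra.smul_def]
    refine Submodule.smul_mem _ (⟨_, algebraMap_mem_fqk c⟩ : fqk F L k) ?_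
    induction i with
    | zero => rwa [pow_zero, act_one]
    | succ i ih =>
      rw [pow_succ', act_mul, show (X : F[X]) = 1 - (1 - X) by ring, act_sub, act_one]
      rw [show (X : F[X]) = 1 - (1 - X) by ring] at ih
      exact sub_mem ih (hX _ ih)

/-- Multiplying a generator of `G` by a normal element of `𝔽_{q^k}` gives an `A`-generator of the
span of `G`. -/
theorem exists_orbit_eq_orbitK (hk : 1 ≤ k) (hjk : j.Coprime k) (hp : (k : F) ≠ 0)
    {v : AlgebraicClosure L} (hv : ∀ a, φ.act a v = 0 ↔ X ^ n ∣ a) :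
    ∃ w, (φ.orbitK v : Set (AlgebraicClosure L)) = φ.orbit w ∧ φ.act (bigF F k ^ n) w = 0 := by
  obtain ⟨l, hl, hN⟩ := exists_normal (F := F) (L := L) hk hjk
  -- On v one may replace a by a polynomial in F(T), and that commutes with scalars.
  have hmul : ∀ a, ∀ μ ∈ fqk F L k, ∃ b : F[X], ∀ ν ∈ fqk F L k,
      ν * φ.act a v = φ.act (b.comp (bigF F k)) (ν * v) := fun a μ hμ => by
    obtain ⟨b, hb⟩ := exists_X_pow_dvd_sub_comp_bigF hk hp a n
    refine ⟨b, fun ν hν => ?_⟩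
    rw [act_comp_bigF_mul hν]
    have := (hv _).2 hb
    rw [act_sub, sub_eq_zero] at this
    rw [this]
  -- Climb the T-filtration of G from its zero end φ_{T^n}G; at i = n all of G is reached.
  have key : ∀ i ≤ n, ∀ a, ∀ μ ∈ fqk F L k,
      μ * φ.act (X ^ (n - i) * a) v ∈ φ.orbit (l * v) := by
    intro i
    induction i with
    | zero =>
      intro _ a μ _
      rw [(hv _).2 (by simp), mul_zero]
      exact zero_mem _
    | succ i ih =>
      intro hi a
      specialize ih (by omega)
      -- By normality of l, only the multiples of φ_u(v) by the conjugates l^{q^{js}} are needed.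
      refine hN _ _ fun s => ?_
      set u := X ^ (n - (i + 1)) * a with hu
      have h1 : l * φ.act u v ∈ φ.orbit (l * v) := by
        obtain ⟨b, hb⟩ := hmul u l hl
        rw [hb l hl]
        exact ⟨_, rfl⟩
      have h2 : φ.act ((1 - X) ^ s) (l * φ.act u v) ∈ φ.orbit (l * v) := act_mem_orbit _ h1
      rw [act_pow_one_sub_X_mul φ hl] at h2
      -- Because (1-T)^s ≡ 1 mod T, applying it to lφ_u(v) gives the conjugate multiple of φ_u(v)
      -- plus an error one step deeper, which the induction hypothesis covers.
      obtain ⟨c, hc⟩ : X ∣ (1 - X : F[X]) ^ s - 1 := by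
        rw [X_dvd_iff, coeff_zero_eq_eval_zero]; simp
      have h3 : φ.act ((1 - X) ^ s) (φ.act u v) =
          φ.act u v + φ.act (X ^ (n - i) * (c * a)) v := by
        rw [← act_mul, ← act_add]
        congr 1
        rw [show n - i = n - (i + 1) + 1 by omega, pow_succ,
          show (1 - X : F[X]) ^ s = 1 + X * c by rw [← hc]; ring, hu]
        congr 1
        ring
      rw [h3, mul_add] at h2
      exact (Submodule.add_mem_iff_left _ (ih _ _ (pow_mem hl _))).1 h2
  refine ⟨l * v, Set.Subset.antisymm ?_ ?_, ?_⟩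
  · rintro _ ⟨r, rfl⟩
    induction r using Polynomial.induction_on' with
    | add p q hp hq => rw [actK_add]; exact add_mem hp hq
    | monomial i μ =>
      rw [← C_mul_X_pow_eq_monomial, actK_mul, actK_C, actK_X_pow]
      simpa using! key n le_rfl (bigF F k ^ i) μ μ.2
  · rintro _ ⟨a, rfl⟩
    rw [← span_orbit_eq hk hp hv]
    exact act_mem_span_orbit a (Submodule.smul_mem _ (⟨l, hl⟩ : fqk F L k)
      (Submodule.subset_span ⟨1, φ.act_one v⟩))
  · rw [act_bigF_pow_mul hl, (hv _).2, mul_zero]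
    rw [bigF_eq_X_mul_smallF, mul_pow]
    exact dvd_mul_right _ _

theorem span_mem_levelM (hk : 1 ≤ k) (hjk : j.Coprime k) (hp : (k : F) ≠ 0)
    {G : Submodule F (AlgebraicClosure L)} (hG : G ∈ levelX φ (X ^ n)) :
    Submodule.span (fqk F L k) (G : Set (AlgebraicClosure L)) ∈ levelM φ n := by
  obtain ⟨⟨v, rfl, hv⟩, hs⟩ := mem_levelX_iff.1 hG
  obtain ⟨w, hw, h0⟩ := exists_orbit_eq_orbitK hk hjk hp hv
  have hK := actK_eq_zero_iff hk hp hv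
  refine mem_levelM_iff.2 ⟨⟨w, ?_, bigF_pow_dvd_of_natCard hk h0 ?_⟩,
    ⟨v, span_orbit_eq hk hp hv, hK⟩, isGaloisStable_of_forall fun ξ x hx => ?_⟩
  · rw [span_orbit_eq hk hp hv, hw]
  · rw [← hw, natCard_orbitK φ hk hK]
  · rw [SetLike.mem_coe] at hx ⊢
    induction hx using Submodule.span_induction with
    | mem x hx => exact Submodule.subset_span (hs.apply_mem ξ hx)
    | zero => rw [map_zero]; exact zero_mem _
    | add x y _ _ hx hy => rw [map_add]; exact add_mem hx hy
    | smul μ x _ hx =>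
      rw [Subfield.smul_def, smul_eq_mul, map_mul]
      exact Submodule.smul_mem _ (⟨_, algEquiv_mem_fqk ξ μ.2⟩ : fqk F L k) hx

/-- If w generates E over A, then φ_{f(T)^n}(w) generates the image; cancelling f(T)^n in F(T)^n =
T^n f(T)^n leaves the annihilator T^n. -/
theorem exists_levelX_of_levelM (hk : 1 ≤ k)
    {E : Submodule (fqk F L k) (AlgebraicClosure L)} (hE : E ∈ levelM φ n) :
    ∃ G ∈ levelX φ (X ^ n), (G : Set (AlgebraicClosure L)) =
      φ.act (smallF F k ^ n) '' (E : Set (AlgebraicClosure L)) := by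
  obtain ⟨⟨w, hw, hI⟩, -, hs⟩ := mem_levelM_iff.1 hE
  have hG : (φ.orbit (φ.act (smallF F k ^ n) w) : Set (AlgebraicClosure L)) =
      φ.act (smallF F k ^ n) '' (E : Set (AlgebraicClosure L)) := by
    rw [hw]
    ext x
    constructor
    · rintro ⟨a, rfl⟩
      exact ⟨φ.act a w, ⟨a, rfl⟩, φ.act_comm _ _ _⟩
    · rintro ⟨_, ⟨a, rfl⟩, rfl⟩
      exact ⟨a, φ.act_comm _ _ _⟩
  refine ⟨_, mem_levelX_iff.2 ⟨⟨_, rfl, fun a => ?_⟩, ?_⟩, hG⟩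
  · rw [← act_mul, hI, bigF_eq_X_mul_smallF, mul_pow]
    exact mul_dvd_mul_iff_right (pow_ne_zero _ (smallF_ne_zero F hk))
  · rw [hG]
    refine isGaloisStable_of_forall fun ξ => ?_
    rintro _ ⟨e, he, rfl⟩
    exact ⟨ξ e, hs.apply_mem ξ he, φ.act_algEquiv ξ _ _⟩

theorem image_subset_levelM {E : Submodule (fqk F L k) (AlgebraicClosure L)} (hE : E ∈ levelM φ n)
    (a : F[X]) : φ.act a '' (E : Set (AlgebraicClosure L)) ⊆ E := by
  obtain ⟨⟨w, hw, -⟩, -⟩ := mem_levelM_iff.1 hE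
  rw [hw]
  rintro _ ⟨x, hx, rfl⟩
  exact act_mem_orbit a hx

/-- From sT^n + t f(T)^n = 1, each g in G is φ_{f(T)^n}(φ_t(g)). This gives one inclusion, and both
sides have q^n elements. -/
theorem image_span_eq (hk : 1 ≤ k) (hjk : j.Coprime k) (hp : (k : F) ≠ 0)
    {G : Submodule F (AlgebraicClosure L)} (hG : G ∈ levelX φ (X ^ n)) :
    φ.act (smallF F k ^ n) '' (Submodule.span (fqk F L k) (G : Set (AlgebraicClosure L)) :
      Set (AlgebraicClosure L)) = G := by
  obtain ⟨G', hG', h⟩ := exists_levelX_of_levelM hk (span_mem_levelM hk hjk hp hG)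
  rw [← h]
  refine (Set.eq_of_subset_of_ncard_le ?_ ?_ (finite_of_mem_levelX hG')).symm
  · rw [h]
    obtain ⟨⟨v, rfl, hv⟩, -⟩ := mem_levelX_iff.1 hG
    rintro _ ⟨a, rfl⟩
    obtain ⟨s, t, e⟩ := isCoprime_X_pow_smallF_pow hk hp n n
    refine ⟨φ.act t (φ.act a v), Submodule.subset_span (act_mem_orbit t ⟨a, rfl⟩), ?_⟩
    have h0 : φ.act (X ^ n) (φ.act a v) = 0 := by
      rw [← act_mul, hv]
      exact dvd_mul_right _ _
    conv_rhs => rw [← φ.act_one ((LinearMap.applyₗ v).comp φ.actHom.toLinearMap a), ← e, act_add]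
    rw [act_mul, act_mul]
    change _ = φ.act s (φ.act (X ^ n) (φ.act a v)) + φ.act t (φ.act _ (φ.act a v))
    rw [h0, map_zero, zero_add, act_comm]
  · rw [natCard_of_mem_levelX hG, natCard_of_mem_levelX hG']

/-- The span lies in E because E is stable under A and 𝔽_{q^k}; both have q^{kn} elements. -/
theorem span_image_eq (hk : 1 ≤ k) (hjk : j.Coprime k) (hp : (k : F) ≠ 0)
    {G : Submodule F (AlgebraicClosure L)} (hG : G ∈ levelX φ (X ^ n))
    {E : Submodule (fqk F L k) (AlgebraicClosure L)} (hE : E ∈ levelM φ n)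
    (h : (G : Set (AlgebraicClosure L)) =
      φ.act (smallF F k ^ n) '' (E : Set (AlgebraicClosure L))) :
    Submodule.span (fqk F L k) (G : Set (AlgebraicClosure L)) = E := by
  refine SetLike.coe_injective (Set.eq_of_subset_of_ncard_le ?_ ?_ (finite_of_mem_levelM hk hE))
  · exact Submodule.span_le.2 (h ▸ image_subset_levelM hE _)
  · rw [natCard_of_mem_levelM hk hE, natCard_of_mem_levelM hk (span_mem_levelM hk hjk hp hG)]

/-- In A/T^nA the elements killed by T are the multiples of T^{n-1}. -/
theorem mem_image_iff_of_mem_levelX (hn : 1 ≤ n) {G : Submodule F (AlgebraicClosure L)}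
    (hG : G ∈ levelX φ (X ^ n)) (x : AlgebraicClosure L) :
    x ∈ G ⊓ LinearMap.ker (φ.act X) ↔
      x ∈ φ.act (X ^ (n - 1)) '' (G : Set (AlgebraicClosure L)) := by
  obtain ⟨⟨v, rfl, hv⟩, -⟩ := mem_levelX_iff.1 hG
  have e : (X : F[X]) ^ n = X * X ^ (n - 1) := by rw [← pow_succ', Nat.sub_add_cancel hn]
  constructor
  · rintro ⟨⟨a, rfl⟩, h⟩
    have h' : φ.act X (φ.act a v) = 0 := h
    rw [← act_mul, hv, e, mul_dvd_mul_iff_left X_ne_zero] at h'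
    obtain ⟨b, rfl⟩ := h'
    exact ⟨φ.act b v, ⟨b, rfl⟩, (φ.act_mul _ _ _).symm⟩
  · rintro ⟨_, ⟨a, rfl⟩, rfl⟩
    refine ⟨act_mem_orbit _ ⟨a, rfl⟩, ?_⟩
    change φ.act X (φ.act _ (φ.act a v)) = 0
    rw [← act_mul, ← act_mul, ← e, hv]
    exact dvd_mul_right _ _

/-- The image of `f(T) ^ n` is the kernel of `T ^ n`. -/
theorem act_X_pow_eq_zero_iff (hk : 1 ≤ k) (hp : (k : F) ≠ 0)
    {E : Submodule (fqk F L k) (AlgebraicClosure L)} (hE : E ∈ levelM φ n)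
    {x : AlgebraicClosure L} (hx : x ∈ E) :
    φ.act (X ^ n) x = 0 ↔
      x ∈ φ.act (smallF F k ^ n) '' (E : Set (AlgebraicClosure L)) := by
  obtain ⟨⟨w, hw, hI⟩, -, -⟩ := mem_levelM_iff.1 hE
  constructor
  · intro h
    obtain ⟨s, t, e⟩ := isCoprime_X_pow_smallF_pow hk hp n n
    refine ⟨φ.act t x, image_subset_levelM hE t ⟨x, hx, rfl⟩, ?_⟩
    conv_rhs => rw [← φ.act_one x, ← e, act_add, act_mul, h, map_zero, zero_add]
    rw [← act_mul, mul_comm]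
  · rintro ⟨y, hy, rfl⟩
    obtain ⟨a, rfl⟩ := hw.subset hy
    change φ.act _ (φ.act _ (φ.act a w)) = 0
    rw [← act_mul, ← act_mul, ← mul_pow, ← bigF_eq_X_mul_smallF, hI]
    exact dvd_mul_right _ _

end NormalizedDrinfeldModule

end Correspondence

/-! ### Symmetric functions of roots -/

section Symmetric

variable {R S : Type*} [CommRing R] [CommRing S]

/-- The monic polynomial whose roots are the values of `H` at the roots of `P`. -/
def valuesPoly (P H : R[X]) : R[X] :=
  resultant (P.map C) (C X - H.map C)

/-- The resultant is taken over R[X]: the variable of P is eliminated, and the inner X remains as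
the variable of the result. -/
theorem map_valuesPoly (ψ : R →+* S) {P : R[X]} (hP : P.Monic) (H : R[X]) (s : Finset S)
    (h : P.map ψ = ∏ v ∈ s, (X - C v)) :
    (valuesPoly P H).map ψ = ∏ v ∈ s, (X - C ((H.map ψ).eval v)) := by
  have := map_resultant_eq_prod (mapRingHom ψ) (hP.map C) (C X - H.map C) s (fun v => C v) (by
    have := congrArg (Polynomial.map (C : S →+* S[X])) h
    rw [Polynomial.map_map] at this
    rw [Polynomial.map_map, mapRingHom_comp_C, this]
    simp [Polynomial.map_prod])
  refine this.trans (Finset.prod_congr rfl fun v _ => ?_)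
  rw [Polynomial.map_sub, Polynomial.map_map, mapRingHom_comp_C, ← Polynomial.map_map, map_C,
    eval_sub, eval_C, Polynomial.eval_map C, eval₂_at_apply, coe_mapRingHom, map_X]

/-- There is a polynomial whose roots are the sums `∑ lᵢ wᵢ` of roots `wᵢ` of `P`. -/
theorem exists_combinationsPoly {R : Type*} [CommRing R] {P : R[X]} (hP : P.Monic) (r : ℕ) (l : Fin r → R) :
    ∃ Q : R[X], ∀ (S : Type u) [CommRing S] (ψ : R →+* S) (s : Finset S), P.map ψ = ∏ v ∈ s, (X - C v) →
      Q.map ψ = ∏ w : Fin r → s, (X - C (∑ i, ψ (l i) * w i)) := by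
  induction r with
  | zero => exact ⟨X, fun S _ ψ s _ => by simp⟩
  | succ r ih =>
    obtain ⟨Q, hQ⟩ := ih (fun i => l i.succ)
    -- Eliminating w₀ between P(w₀) and Q(Y - l₀w₀) adds one more summand.
    refine ⟨resultant (P.map C) (eval₂ (C.comp C) (C X - C (C (l 0)) * X) Q), fun S _ ψ s h => ?_⟩
    have := map_resultant_eq_prod (mapRingHom ψ) (hP.map C)
      (eval₂ (C.comp C) (C X - C (C (l 0)) * X) Q) s (fun v => C v) (by
      have := congrArg (Polynomial.map (C : S →+* S[X])) h
      rw [Polynomial.map_map] at this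
      rw [Polynomial.map_map, mapRingHom_comp_C, this]
      simp [Polynomial.map_prod])
    refine this.trans ?_
    rw [← (Fin.consEquiv fun _ => s).prod_comp, Fintype.prod_prod_type, ← Finset.prod_coe_sort]
    refine Finset.prod_congr rfl fun v _ => ?_
    rw [Polynomial.eval_map, ← coe_eval₂RingHom, hom_eval₂]
    have e : (eval₂RingHom (mapRingHom ψ) (C (v : S))).comp ((C : R[X] →+* R[X][X]).comp C) =
        C.comp ψ := by
      ext; simp
    rw [e, ← eval₂_map, hQ S ψ s h, eval₂_finsetProd]
    refine Finset.prod_congr rfl fun w _ => ?_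
    rw [eval₂_sub, eval₂_X, eval₂_C]
    simp [Fin.sum_univ_succ, sub_sub]

end Symmetric

/-! ### Coordinates -/

section Coordinates

variable {S : Type*} [CommRing S] {d : ℕ}

variable (S d) in
/-- The monic polynomial of degree `d` with indeterminate coefficients. -/
def genericEquation : (MvPolynomial (Coord.{u} d) S)[X] :=
  X ^ d + ∑ i : Fin d, C (MvPolynomial.X (.coeff i)) * X ^ (i : ℕ)

theorem monic_genericEquation : (genericEquation.{u} S d).Monic :=
  monic_X_pow_add (degree_sum_fin_lt _)

theorem natDegree_genericEquation [Nontrivial S] :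
    (genericEquation.{u} S d).natDegree = d := by
  refine natDegree_eq_of_degree_eq_some ?_
  rw [genericEquation, degree_add_eq_left_of_degree_lt, degree_X_pow]
  rw [degree_X_pow]
  exact degree_sum_fin_lt _

theorem coeff_genericEquation (i : Fin d) :
    (genericEquation.{u} S d).coeff i = MvPolynomial.X (.coeff i) := by
  rw [genericEquation, coeff_add, coeff_X_pow, if_neg i.2.ne, zero_add, finsetSum_coeff,
    Finset.sum_eq_single i]
  · simp
  · intro b _ hb
    rw [coeff_C_mul, coeff_X_pow, if_neg fun h => hb (Fin.ext h.symm), mul_zero]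
  · simp

theorem Monic.eq_X_pow_add_sum {R : Type*} [CommRing R] {P : R[X]} (hP : P.Monic)
    (hd : P.natDegree = d) : P = X ^ d + ∑ i : Fin d, C (P.coeff i) * X ^ (i : ℕ) := by
  conv_lhs => rw [hP.as_sum, hd]
  rw [Finset.sum_range]

theorem map_genericEquation {R : Type*} [CommRing R] (ψ : MvPolynomial (Coord.{u} d) S →+* R)
    {P : R[X]} (hP : P.Monic) (hd : P.natDegree = d)
    (h : ∀ i : Fin d, ψ (MvPolynomial.X (.coeff i)) = P.coeff i) :
    (genericEquation S d).map ψ = P := by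
  conv_rhs => rw [Monic.eq_X_pow_add_sum hP hd]
  simp [genericEquation, Polynomial.map_sum, h]

variable {F : Type u} [Field F] [Fintype F] {L : Type u} [Field L] [Algebra F L] {j k n : ℕ}

variable (j k d) in
/-- `φ_a` with the coordinate `g` as coefficient. -/
def genericAct (a : F[X]) : (MvPolynomial (Coord.{u} d) F)[X] :=
  (actPoly j k a).map (aeval (MvPolynomial.X .g) : F[X] →ₐ[F] MvPolynomial (Coord.{u} d) F).toRingHom

theorem eval_map_genericAct (φ : NormalizedDrinfeldModule F L j k)
    (c : Coord.{u} d → AlgebraicClosure L) (hc : c .g = algebraMap L (AlgebraicClosure L) φ.g)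
    (a : F[X]) (v : AlgebraicClosure L) :
    ((genericAct d j k a).map (MvPolynomial.aeval c : _ →ₐ[F] _).toRingHom).eval v =
      φ.act a v := by
  rw [← eval_map_actPoly, genericAct, Polynomial.map_map]
  congr 2
  ext <;> simp [hc]

theorem map_genericEquation_X (s : XTriple F L j k n)
    (ψ : MvPolynomial (Coord.{u} (Fintype.card F ^ n)) S →+* AlgebraicClosure L)
    (hψ : ∀ c, ψ (MvPolynomial.X c) = s.coord c) :
    (genericEquation S (Fintype.card F ^ n)).map ψ =
      equation (s.G : Set (AlgebraicClosure L)) := by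
  have hf := NormalizedDrinfeldModule.finite_of_mem_levelX s.G_mem
  refine map_genericEquation ψ (monic_equation hf) ?_ fun i => hψ _
  rw [natDegree_equation hf, NormalizedDrinfeldModule.natCard_of_mem_levelX s.G_mem]

theorem map_genericEquation_M (hk : 1 ≤ k) (t : MTriple F L j k n)
    (ψ : MvPolynomial (Coord.{u} (Fintype.card F ^ (k * n))) S →+* AlgebraicClosure L)
    (hψ : ∀ c, ψ (MvPolynomial.X c) = t.coord c) :
    (genericEquation S (Fintype.card F ^ (k * n))).map ψ =
      equation (t.E : Set (AlgebraicClosure L)) := by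
  have hf := NormalizedDrinfeldModule.finite_of_mem_levelM hk t.E_mem
  refine map_genericEquation ψ (monic_equation hf) ?_ fun i => hψ _
  rw [natDegree_equation hf, NormalizedDrinfeldModule.natCard_of_mem_levelM hk t.E_mem]

variable (F j k n) in
/-- The coordinates of `(φ, φ_{f(T) ^ n} E, x)` are polynomials in those of `(φ, E, x)`. -/
theorem exists_coordX_eq_aeval_coordM (hj : 1 ≤ j) (hk : 1 ≤ k) (hp : (k : F) ≠ 0) :
    ∃ a : Coord.{u} (Fintype.card F ^ n) → MvPolynomial (Coord.{u} (Fintype.card F ^ (k * n))) F,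
      ∀ (L : Type u) [Field L] [Algebra F L] (t : MTriple F L j k n) (s : XTriple F L j k n),
        s.φ = t.φ → s.x = t.x → (s.G : Set (AlgebraicClosure L)) =
          t.φ.act (smallF F k ^ n) '' (t.E : Set (AlgebraicClosure L)) →
        ∀ c, MvPolynomial.aeval t.coord (a c) = s.coord c := by
  classical
  let d := Fintype.card F ^ (k * n)
  -- With B the polynomial of φ_{f(T)^n}, this is H(y) = (B(z)/z)·y at z = φ_{T^n}(y). On E it is
  -- the identity on G and zero elsewhere.
  let H : (MvPolynomial (Coord.{u} d) F)[X] :=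
    (divX (genericAct d j k (smallF F k ^ n))).comp (genericAct d j k (X ^ n)) * X
  let Q := valuesPoly (genericEquation F d) H
  refine ⟨fun c => match c with
    | .g => MvPolynomial.X .g
    | .x => MvPolynomial.X .x
    -- The d - q^n points of E outside G are sent to 0 and contribute a power of Y, which shifts the
    -- index.
    | .coeff i => Q.coeff (i + (d - Fintype.card F ^ n)), fun L _ _ t s hφ hx hG c => ?_⟩
  cases c with
  | g => simp [MTriple.coord, XTriple.coord, hφ]
  | x => simp [MTriple.coord, XTriple.coord, hx]
  | coeff i =>
    have hfE := NormalizedDrinfeldModule.finite_of_mem_levelM hk t.E_mem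
    have hfG := NormalizedDrinfeldModule.finite_of_mem_levelX s.G_mem
    let ψ := (MvPolynomial.aeval t.coord : MvPolynomial _ F →ₐ[F] AlgebraicClosure L).toRingHom
    have hval : ∀ v ∈ t.E, (H.map ψ).eval v = if v ∈ s.G then v else 0 := by
      intro v hv
      have hGv : v ∈ s.G ↔ t.φ.act (X ^ n) v = 0 := by
        rw [NormalizedDrinfeldModule.act_X_pow_eq_zero_iff hk hp t.E_mem hv, ← hG]
        rfl
      have hA := fun a => eval_map_genericAct t.φ t.coord rfl a
      let B := (genericAct d j k (smallF F k ^ n)).map ψ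
      have hdiv : B = X * (divX (genericAct d j k (smallF F k ^ n))).map ψ := by
        have h0 : (genericAct d j k (smallF F k ^ n)).coeff 0 = 0 := by
          rw [genericAct, coeff_map, coeff_zero_actPoly, map_zero]
        have := X_mul_divX_add (genericAct d j k (smallF F k ^ n))
        rw [h0, C_0, add_zero] at this
        simp only [B]
        conv_lhs => rw [← this]
        simp
      -- On G one has z = 0, and B(z)/z takes there the value of the linear coefficient of B, which
      -- is f(1)^n = 1.
      have h1 : ((divX (genericAct d j k (smallF F k ^ n))).map ψ).eval 0 = 1 := by
        have h2 : derivative B = 1 := by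
          simp [B, genericAct, derivative_map, derivative_actPoly hj, eval_one_smallF F hk]
        have := congrArg (eval 0) h2
        rw [hdiv] at this
        simpa using this
      have hH : (H.map ψ).eval v =
          ((divX (genericAct d j k (smallF F k ^ n))).map ψ).eval (t.φ.act (X ^ n) v) * v := by
        rw [← hA, Polynomial.map_mul, Polynomial.map_comp, eval_mul, eval_comp, map_X, eval_X]
      rw [hH]
      split_ifs with h
      · rw [hGv.1 h, h1, one_mul]
      -- Off G, z is nonzero, yet B(z) = φ_{T^n}(φ_{f(T)^n}(v)) = 0 because φ_{f(T)^n}(v) lies in G.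
      · have h3 : B.eval (t.φ.act (X ^ n) v) = 0 := by
          rw [hA, t.φ.act_comm]
          have : t.φ.act (smallF F k ^ n) v ∈ s.G := hG.symm.subset ⟨v, hv, rfl⟩
          have h4 := s.G_mem.1 this
          rwa [LinearMap.mem_ker, hφ] at h4
        rw [hdiv, eval_mul, eval_X] at h3
        rw [(mul_eq_zero.1 h3).resolve_left (fun h' => h (hGv.2 h')), zero_mul]
    have hQ : Q.map ψ = equation (s.G : Set (AlgebraicClosure L)) *
        X ^ (d - Fintype.card F ^ n) := by
      have hsub : hfG.toFinset ⊆ hfE.toFinset := by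
        rw [Set.Finite.toFinset_subset_toFinset, hG]
        exact NormalizedDrinfeldModule.image_subset_levelM t.E_mem _
      rw [map_valuesPoly ψ monic_genericEquation H hfE.toFinset
        ((map_genericEquation_M hk t ψ fun c => by simp [ψ]).trans (equation_eq_prod hfE)),
        equation_eq_prod hfG, ← Finset.prod_sdiff hsub, mul_comm]
      congr 1
      · refine Finset.prod_congr rfl fun v hv => ?_
        rw [hval v (hfE.mem_toFinset.1 (hsub hv)), if_pos (by simpa using hv)]
      · rw [Finset.prod_congr rfl fun v hv => ?_, Finset.prod_const, Finset.card_sdiff_of_subset hsub,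
          ← Set.ncard_eq_toFinset_card _ hfE, ← Set.ncard_eq_toFinset_card _ hfG,
          NormalizedDrinfeldModule.natCard_of_mem_levelX s.G_mem,
          NormalizedDrinfeldModule.natCard_of_mem_levelM hk t.E_mem]
        have hv' := Finset.mem_sdiff.1 hv
        rw [hval v (by simpa using hv'.1), if_neg (by simpa using hv'.2)]
        simp
    have := congrArg (fun p => p.coeff (i + (d - Fintype.card F ^ n))) hQ
    simp only [coeff_map, coeff_mul_X_pow] at this
    exact this

/-! ### Descent of coefficients along a finite extension of the base field -/

theorem exists_descent (Λ : Type*) [Field Λ] [Algebra F Λ] [FiniteDimensional F Λ] {ι : Type*}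
    (p : MvPolynomial ι Λ) : ∃ P : MvPolynomial ι F,
      ∀ (Ω : Type u) [Field Ω] [Algebra F Ω] [IsAlgClosed Ω] (c : ι → Ω) (e : Ω),
        (∀ σ : Λ →ₐ[F] Ω, MvPolynomial.eval₂ σ.toRingHom c p = e) → MvPolynomial.aeval c P = e := by
  -- The weights σ(ω) sum to Tr ω = 1, so the weighted sum of the conjugates of p has coefficients
  -- in F and keeps any value common to all embeddings.
  obtain ⟨ω, hω⟩ := Algebra.trace_surjective F Λ 1
  have key : ∃ P : MvPolynomial ι F,
      ∀ (Ω : Type u) [Field Ω] [Algebra F Ω] [IsAlgClosed Ω] (c : ι → Ω),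
        MvPolynomial.aeval c P = ∑ σ : Λ →ₐ[F] Ω, σ ω * MvPolynomial.eval₂ σ.toRingHom c p := by
    induction p using MvPolynomial.induction_on' with
    | monomial m a =>
      refine ⟨MvPolynomial.monomial m (Algebra.trace F Λ (ω * a)), fun Ω _ _ _ c => ?_⟩
      rw [MvPolynomial.aeval_monomial, trace_eq_sum_embeddings Ω, Finset.sum_mul]
      refine Finset.sum_congr rfl fun σ _ => ?_
      rw [MvPolynomial.eval₂_monomial, map_mul, mul_assoc]
      rfl
    | add p q hp hq =>
      obtain ⟨P, hP⟩ := hp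
      obtain ⟨Q, hQ⟩ := hq
      refine ⟨P + Q, fun Ω _ _ _ c => ?_⟩
      rw [map_add, hP, hQ, ← Finset.sum_add_distrib]
      exact Finset.sum_congr rfl fun σ _ => by rw [MvPolynomial.eval₂_add, mul_add]
  obtain ⟨P, hP⟩ := key
  refine ⟨P, fun Ω _ _ _ c e h => ?_⟩
  rw [hP, Finset.sum_congr rfl fun σ _ => by rw [h σ], ← Finset.sum_mul,
    ← trace_eq_sum_embeddings Ω, hω, map_one, one_mul]

/-- Expanding scalars in the basis b gives all of the span; there are as many k-tuples in G as
elements of the span, namely q^{kn}, so the map is injective. -/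
theorem bijective_combinations (hk : 1 ≤ k) (hjk : j.Coprime k) (hp : (k : F) ≠ 0)
    {Λ : Type*} [Field Λ] [Algebra F Λ] [FiniteDimensional F Λ] (hΛ : Module.finrank F Λ = k)
    (b : Module.Basis (Fin k) F Λ) (σ : Λ →ₐ[F] AlgebraicClosure L)
    {φ : NormalizedDrinfeldModule F L j k}
    {G : Submodule F (AlgebraicClosure L)} (hG : G ∈ levelX φ (X ^ n)) :
    Function.Injective (fun w : Fin k → G => ∑ i, σ (b i) * (w i : AlgebraicClosure L)) ∧
    Set.range (fun w : Fin k → G => ∑ i, σ (b i) * (w i : AlgebraicClosure L)) =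
      Submodule.span (fqk F L k) (G : Set (AlgebraicClosure L)) := by
  have hfG : Finite G := NormalizedDrinfeldModule.finite_of_mem_levelX hG
  let f : (Fin k → G) →ₗ[F] AlgebraicClosure L :=
    { toFun := fun w => ∑ i, σ (b i) * (w i : AlgebraicClosure L)
      map_add' := fun v w => by simp [mul_add, Finset.sum_add_distrib]
      map_smul' := fun c w => by simp [Finset.smul_sum] }
  have hr : (LinearMap.range f : Set (AlgebraicClosure L)) =
      Submodule.span (fqk F L k) (G : Set (AlgebraicClosure L)) := by
    refine Set.Subset.antisymm ?_ fun x hx => ?_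
    · rintro _ ⟨w, rfl⟩
      change ∑ i, σ (b i) * (w i : AlgebraicClosure L) ∈ Submodule.span _ _
      exact Submodule.sum_mem _ fun i _ => Submodule.smul_mem _
        (⟨σ (b i), (range_eq_fqk hk hΛ σ).subset ⟨_, rfl⟩⟩ : fqk F L k)
        (Submodule.subset_span (w i).2)
    -- The range is known only to be an F-subspace, so the span induction has to carry all
    -- 𝔽_{q^k}-multiples of x.
    · have key : ∀ μ ∈ fqk F L k, μ * x ∈ LinearMap.range f := by
        rw [SetLike.mem_coe] at hx
        induction hx using Submodule.span_induction with
        | mem x hx =>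
          intro μ hμ
          obtain ⟨y, rfl⟩ := (range_eq_fqk hk hΛ σ).symm.subset hμ
          refine ⟨fun i => b.repr y i • ⟨x, hx⟩, ?_⟩
          conv_rhs => rw [← b.sum_repr y, map_sum, Finset.sum_mul]
          simp [f]
        | zero => intro μ _; rw [mul_zero]; exact zero_mem _
        | add x y _ _ hx hy =>
          intro μ hμ
          rw [mul_add]
          exact add_mem (hx μ hμ) (hy μ hμ)
        | smul ν x _ hx =>
          intro μ hμ
          rw [Subfield.smul_def, smul_eq_mul, ← mul_assoc]
          exact hx _ (mul_mem hμ ν.2)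
      simpa using key 1 (one_mem _)
  refine ⟨?_, hr⟩
  have hcard : Nat.card (Fin k → G) ≤ Nat.card (LinearMap.range f) := by
    have h1 : Nat.card (LinearMap.range f) = Fintype.card F ^ (k * n) := by
      rw [← NormalizedDrinfeldModule.natCard_of_mem_levelM hk
        (NormalizedDrinfeldModule.span_mem_levelM hk hjk hp hG), ← hr]
      rfl
    have h2 : Nat.card G = Fintype.card F ^ n := NormalizedDrinfeldModule.natCard_of_mem_levelX hG
    rw [h1, Nat.card_fun, h2, Nat.card_fin, ← pow_mul, mul_comm]
  have := (f.surjective_rangeRestrict.bijective_of_nat_card_le hcard).1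
  exact fun v w h => this (Subtype.ext h)

variable (F j k n) in
/-- The coordinates of `(φ, 𝔽_{q^k}⟨G⟩, x)` are polynomials in those of `(φ, G, x)`. -/
theorem exists_coordM_eq_aeval_coordX (hk : 1 ≤ k) (hjk : j.Coprime k) (hp : (k : F) ≠ 0) :
    ∃ a : Coord.{u} (Fintype.card F ^ (k * n)) → MvPolynomial (Coord.{u} (Fintype.card F ^ n)) F,
      ∀ (L : Type u) [Field L] [Algebra F L] (t : MTriple F L j k n) (s : XTriple F L j k n),
        s.φ = t.φ → s.x = t.x →
          t.E = Submodule.span (fqk F L k) (s.G : Set (AlgebraicClosure L)) →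
        ∀ c, MvPolynomial.aeval s.coord (a c) = t.coord c := by
  classical
  obtain ⟨Λ, _, _, _, hΛ⟩ := exists_extension_finrank F hk
  let b := Module.finBasisOfFinrankEq F Λ hΛ
  obtain ⟨Q, hQ⟩ := exists_combinationsPoly
    (monic_genericEquation (S := Λ) (d := Fintype.card F ^ n)) k (fun i => MvPolynomial.C (b i))
  choose P hP using fun i => exists_descent (F := F) Λ (Q.coeff i)
  refine ⟨fun c => match c with
    | .g => MvPolynomial.X .g
    | .x => MvPolynomial.X .x
    | .coeff i => P i, fun L _ _ t s hφ hx hE c => ?_⟩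
  cases c with
  | g => simp [MTriple.coord, XTriple.coord, hφ]
  | x => simp [MTriple.coord, XTriple.coord, hx]
  | coeff i =>
    -- Every embedding σ of Λ sends the basis b to a basis of the same field 𝔽_{q^k}, so each
    -- conjugate of Q specializes to the equation of the same E.
    refine hP _ _ _ _ fun σ => ?_
    have hfG := NormalizedDrinfeldModule.finite_of_mem_levelX s.G_mem
    obtain ⟨hinj, hrange⟩ := bijective_combinations hk hjk hp hΛ b σ s.G_mem
    let ψ := MvPolynomial.eval₂Hom σ.toRingHom s.coord
    have h := hQ _ ψ hfG.toFinset
      ((map_genericEquation_X s ψ fun c => by simp [ψ]).trans (equation_eq_prod hfG))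
    have hQE : Q.map ψ = equation (t.E : Set (AlgebraicClosure L)) := by
      rw [h, hE, ← hrange]
      have : Finite s.G := hfG
      have := Fintype.ofFinite s.G
      let e : s.G ≃ hfG.toFinset := Equiv.subtypeEquivRight fun v => by simp
      rw [← Set.image_univ, ← Finset.coe_univ, ← Finset.coe_image, equation_coe,
        Finset.prod_image fun v _ w _ h => hinj h,
        ← (Equiv.arrowCongr (Equiv.refl (Fin k)) e).prod_comp]
      refine Finset.prod_congr rfl fun w _ => ?_
      simp [ψ, e]
    rw [← MvPolynomial.coe_eval₂Hom]
    exact (coeff_map ψ _).symm.trans (congrArg (fun p => p.coeff i) hQE)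

end Coordinates

/-! ### The correspondence between triples -/

section Triples

variable {F : Type u} [Field F] [Fintype F] {L : Type u} [Field L] [Algebra F L] {j k n : ℕ}

theorem XTriple.ext_of_eq {s s' : XTriple F L j k n} (hφ : s.φ = s'.φ) (hG : s.G = s'.G)
    (hx : s.x = s'.x) : s = s' := by
  cases s
  cases s'
  simp_all

theorem MTriple.ext_of_eq {t t' : MTriple F L j k n} (hφ : t.φ = t'.φ) (hE : t.E = t'.E)
    (hx : t.x = t'.x) : t = t' := by
  cases t
  cases t'
  simp_all

theorem XTriple.coord_injective :
    Function.Injective (XTriple.coord : XTriple F L j k n → _) := by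
  intro s s' h
  have hinj := (algebraMap L (AlgebraicClosure L)).injective
  have hf := NormalizedDrinfeldModule.finite_of_mem_levelX s.G_mem
  have hf' := NormalizedDrinfeldModule.finite_of_mem_levelX s'.G_mem
  refine XTriple.ext_of_eq (NormalizedDrinfeldModule.ext_g (hinj (congrFun h .g)))
    (SetLike.coe_injective (equation_injOn hf hf' ?_)) (hinj (congrFun h .x))
  rw [Monic.eq_X_pow_add_sum (d := Fintype.card F ^ n) (monic_equation hf),
    Monic.eq_X_pow_add_sum (d := Fintype.card F ^ n) (monic_equation hf')]
  · congr 1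
    exact Finset.sum_congr rfl fun i _ => congrArg (C · * X ^ (i : ℕ)) (congrFun h (.coeff i))
  · rw [natDegree_equation hf', NormalizedDrinfeldModule.natCard_of_mem_levelX s'.G_mem]
  · rw [natDegree_equation hf, NormalizedDrinfeldModule.natCard_of_mem_levelX s.G_mem]

theorem XTriple.coord_mem_range (hj : 1 ≤ j) (s : XTriple F L j k n)
    (c : Coord.{u} (Fintype.card F ^ n)) :
    s.coord c ∈ Set.range (algebraMap L (AlgebraicClosure L)) := by
  cases c with
  | g => exact ⟨_, rfl⟩
  | x => exact ⟨_, rfl⟩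
  | coeff i =>
    exact equation_mem_lifts (NormalizedDrinfeldModule.finite_of_mem_levelX s.G_mem)
      (fun γ hγ => isSeparable_of_act_eq_zero s.φ hj (a := X ^ n) (by simp) (s.G_mem.1 hγ))
      s.G_mem.2.2 i

/-- The bijection `(φ, E, x) ↦ (φ, φ_{f(T) ^ n} E, x)`. -/
def levelEquiv (hk : 1 ≤ k) (hjk : j.Coprime k) (hp : (k : F) ≠ 0) (hn : 1 ≤ n) :
    MTriple F L j k n ≃ XTriple F L j k n where
  toFun t :=
    let h := NormalizedDrinfeldModule.exists_levelX_of_levelM hk t.E_mem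
    { φ := t.φ
      G := h.choose
      G_mem := h.choose_spec.1
      x := t.x
      x_ne_zero := t.x_ne_zero
      -- The marked point lies in φ_{T^{n-1}f(T)^n}E = φ_{T^{n-1}}G = G ∩ Ker φ_T.
      x_mem := by
        rw [NormalizedDrinfeldModule.mem_image_iff_of_mem_levelX hn h.choose_spec.1,
          h.choose_spec.2, ← Set.image_comp]
        have := t.x_mem
        rwa [funext (NormalizedDrinfeldModule.act_mul t.φ _ _)] at this }
  invFun s :=
    { φ := s.φ
      E := Submodule.span (fqk F L k) (s.G : Set (AlgebraicClosure L))
      E_mem := NormalizedDrinfeldModule.span_mem_levelM hk hjk hp s.G_mem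
      x := s.x
      x_ne_zero := s.x_ne_zero
      x_mem := by
        rw [funext (NormalizedDrinfeldModule.act_mul s.φ _ _)]
        have := (NormalizedDrinfeldModule.mem_image_iff_of_mem_levelX hn s.G_mem _).1 s.x_mem
        rw [← NormalizedDrinfeldModule.image_span_eq hk hjk hp s.G_mem, ← Set.image_comp] at this
        exact this }
  left_inv t := by
    have h := NormalizedDrinfeldModule.exists_levelX_of_levelM hk t.E_mem
    refine MTriple.ext_of_eq rfl ?_ rfl
    exact NormalizedDrinfeldModule.span_image_eq hk hjk hp h.choose_spec.1 t.E_mem h.choose_spec.2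
  right_inv s := by
    have h := NormalizedDrinfeldModule.exists_levelX_of_levelM hk
      (NormalizedDrinfeldModule.span_mem_levelM hk hjk hp s.G_mem)
    refine XTriple.ext_of_eq rfl ?_ rfl
    exact SetLike.coe_injective (h.choose_spec.2.trans
      (NormalizedDrinfeldModule.image_span_eq hk hjk hp s.G_mem))

theorem coe_levelEquiv_G (hk : 1 ≤ k) (hjk : j.Coprime k) (hp : (k : F) ≠ 0) (hn : 1 ≤ n)
    (t : MTriple F L j k n) :
    ((levelEquiv hk hjk hp hn t).G : Set (AlgebraicClosure L)) =
      t.φ.act (smallF F k ^ n) '' (t.E : Set (AlgebraicClosure L)) :=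
  (NormalizedDrinfeldModule.exists_levelX_of_levelM hk t.E_mem).choose_spec.2

/-! ### The equations of the curve -/

theorem equation_dvd_iff {V : Set (AlgebraicClosure L)} (hV : V.Finite)
    (H : (AlgebraicClosure L)[X]) : equation V ∣ H ↔ ∀ v ∈ V, H.eval v = 0 := by
  constructor
  · rintro ⟨Q, rfl⟩ v hv
    rw [eval_mul, (eval_equation_eq_zero hV v).2 hv, zero_mul]
  · intro h
    rw [equation_eq_prod hV]
    refine Finset.prod_dvd_of_coprime (fun v _ w _ hvw =>
      pairwise_coprime_X_sub_C Function.injective_id hvw) fun v hv => ?_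
    exact dvd_iff_isRoot.2 (h v (hV.mem_toFinset.1 hv))

/-- If T^n does not divide a, the ideal generated by T^n and a contains T^{n-1}, which does not kill
v. -/
theorem X_pow_dvd_of_act_eq_zero (hn : 1 ≤ n) (φ : NormalizedDrinfeldModule F L j k)
    {v : AlgebraicClosure L}
    (h0 : φ.act (X ^ n) v = 0) (h1 : φ.act (X ^ (n - 1)) v ≠ 0) (a : F[X]) :
    φ.act a v = 0 ↔ X ^ n ∣ a := by
  constructor
  · intro h
    rcases eq_or_ne a 0 with rfl | ha
    · exact dvd_zero _
    obtain ⟨s, hs, hd⟩ := exists_eq_pow_rootMultiplicity_mul_and_not_dvd a ha 0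
    rw [C_0, sub_zero] at hs hd
    set i := rootMultiplicity 0 a
    by_contra hna
    have hi : i < n := by
      by_contra hi
      exact hna (hs ▸ (pow_dvd_pow X (not_lt.1 hi)).trans (dvd_mul_right _ _))
    have hs0 : s.eval 0 ≠ 0 := fun h0 => hd (X_dvd_iff.2 (by rwa [coeff_zero_eq_eval_zero]))
    obtain ⟨p, q, e⟩ := isCoprime_X_pow_of_eval_ne_zero hs0 1
    refine h1 ?_
    have : (X : F[X]) ^ (n - 1) = p * X ^ n + q * X ^ (n - 1 - i) * a := by
      calc _ = X ^ (n - 1) * (p * X ^ 1 + q * s) := by rw [e, mul_one]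
        _ = p * X ^ (n - 1 + 1) + q * (X ^ (n - 1 - i + i) * s) := by
          rw [Nat.sub_add_cancel (by omega : i ≤ n - 1)]; ring
        _ = _ := by
          rw [Nat.sub_add_cancel hn, pow_add]
          conv_rhs => rw [hs]
          ring
    rw [this, φ.act_add, φ.act_mul, h0, φ.act_mul _ a, h, map_zero, map_zero, add_zero]
  · rintro ⟨c, rfl⟩
    rw [mul_comm, φ.act_mul, h0, map_zero]

/-- This is φ_T(x) = 0 divided by x. For j ≥ 1 it has no solution with x = 0, so it expresses x ≠ 0
by a polynomial equation. -/
theorem XTriple.act_X_x (s : XTriple F L j k n) :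
    -s.x ^ (Fintype.card F ^ (j + k) - 1) + s.φ.g * s.x ^ (Fintype.card F ^ j - 1) + 1 = 0 := by
  have h : s.φ.act X (algebraMap L (AlgebraicClosure L) s.x) = 0 := s.x_mem.2
  rw [s.φ.act_X] at h
  have hpow : ∀ i, s.x ^ Fintype.card F ^ i = s.x ^ (Fintype.card F ^ i - 1) * s.x := fun i => by
    rw [← pow_succ, Nat.sub_add_cancel (Nat.pos_of_ne_zero (pow_ne_zero _ Fintype.card_ne_zero))]
  rw [← map_pow, ← map_pow, ← map_mul, ← map_neg, ← map_add, ← map_add, map_eq_zero_iff _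
    (algebraMap L (AlgebraicClosure L)).injective, hpow, hpow] at h
  refine (mul_eq_zero.1 (?_ : _ * s.x = 0)).resolve_right s.x_ne_zero
  rw [← h]
  ring

theorem exists_root_of_map_resultant_eq_zero {R Ω : Type*} [CommRing R] [Field Ω] [IsAlgClosed Ω]
    (ψ : R →+* Ω) {P : R[X]} (hP : P.Monic) (H : R[X])
    (h : ψ (resultant P H) = 0) : ∃ v, (P.map ψ).eval v = 0 ∧ (H.map ψ).eval v = 0 := by
  rw [← resultant_map_map, ← hP.natDegree_map ψ, resultant_eq_prod_eval _ _ _ natDegree_map_le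
    (IsAlgClosed.splits _), (hP.map ψ).leadingCoeff, one_pow, one_mul, Multiset.prod_eq_zero_iff,
    Multiset.mem_map] at h
  obtain ⟨v, hv, h⟩ := h
  exact ⟨v, isRoot_of_mem_roots hv, h⟩

variable (F j k n) in
/-- The product over `v ∈ G` of `x - φ_{T ^ (n - 1)}(v)`, as a polynomial in the coordinates. -/
def markedPointRelation : MvPolynomial (Coord.{u} (Fintype.card F ^ n)) F :=
  resultant (genericEquation F (Fintype.card F ^ n))
    (C (MvPolynomial.X .x) - genericAct (Fintype.card F ^ n) j k (X ^ (n - 1)))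

theorem XTriple.aeval_markedPointRelation (hn : 1 ≤ n) (s : XTriple F L j k n) :
    MvPolynomial.aeval s.coord (markedPointRelation F j k n) = 0 := by
  have hf := NormalizedDrinfeldModule.finite_of_mem_levelX s.G_mem
  obtain ⟨y, hy, hyx⟩ :=
    (NormalizedDrinfeldModule.mem_image_iff_of_mem_levelX hn s.G_mem _).1 s.x_mem
  let ψ := (MvPolynomial.aeval s.coord :
    MvPolynomial (Coord.{u} (Fintype.card F ^ n)) F →ₐ[F] AlgebraicClosure L).toRingHom
  have h := map_resultant_eq_prod ψ monic_genericEquation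
    (C (MvPolynomial.X .x) - genericAct (Fintype.card F ^ n) j k (X ^ (n - 1))) hf.toFinset id
    ((map_genericEquation_X s ψ fun c => by simp [ψ]).trans (equation_eq_prod hf))
  refine h.trans (Finset.prod_eq_zero (hf.mem_toFinset.2 hy) ?_)
  rw [id, Polynomial.map_sub, eval_sub, eval_map_genericAct s.φ s.coord rfl, hyx, map_C, eval_C]
  simp [ψ, XTriple.coord]

theorem exists_root_of_markedPointRelation {Ω : Type*} [Field Ω] [IsAlgClosed Ω]
    (ψ : MvPolynomial (Coord.{u} (Fintype.card F ^ n)) F →+* Ω)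
    (h : ψ (markedPointRelation F j k n) = 0) :
    ∃ v, ((genericEquation F (Fintype.card F ^ n)).map ψ).eval v = 0 ∧
      ((genericAct (Fintype.card F ^ n) j k (X ^ (n - 1))).map ψ).eval v =
        ψ (MvPolynomial.X .x) := by
  obtain ⟨v, h1, h2⟩ := exists_root_of_map_resultant_eq_zero ψ monic_genericEquation _ h
  refine ⟨v, h1, ?_⟩
  rw [Polynomial.map_sub, eval_sub, sub_eq_zero, map_C, eval_C] at h2
  exact h2.symm

/-- Stability of G under φ_a means that its equation divides its own composite with φ_a; these
coefficients of the remainder say so polynomially. -/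
theorem XTriple.aeval_coeff_modByMonic_eq_zero (s : XTriple F L j k n) (a : F[X]) (i : ℕ) :
    MvPolynomial.aeval s.coord (((genericEquation F (Fintype.card F ^ n)).comp
      (genericAct (Fintype.card F ^ n) j k a) %ₘ
        genericEquation F (Fintype.card F ^ n)).coeff i) = 0 := by
  have hf := NormalizedDrinfeldModule.finite_of_mem_levelX s.G_mem
  let ψ := (MvPolynomial.aeval s.coord :
    MvPolynomial (Coord.{u} (Fintype.card F ^ n)) F →ₐ[F] AlgebraicClosure L).toRingHom
  change ψ _ = 0
  have hE := map_genericEquation_X (S := F) s ψ fun c => by simp [ψ]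
  rw [← coeff_map, map_modByMonic ψ monic_genericEquation, Polynomial.map_comp, hE,
    (modByMonic_eq_zero_iff_dvd (monic_equation hf)).2, coeff_zero]
  refine (equation_dvd_iff hf _).2 fun v hv => ?_
  rw [eval_comp, eval_map_genericAct s.φ s.coord rfl, eval_equation_eq_zero hf]
  obtain ⟨⟨v₀, hG, -⟩, -⟩ := NormalizedDrinfeldModule.mem_levelX_iff.1 s.G_mem
  rw [hG] at hv ⊢
  exact NormalizedDrinfeldModule.act_mem_orbit a hv

/-- A tuple over `L` that satisfies all equations satisfied by the triples comes from a triple. -/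
theorem exists_XTriple_of_forall_aeval_eq_zero (hj : 1 ≤ j) (hn : 1 ≤ n)
    (c : Coord.{u} (Fintype.card F ^ n) → L)
    (h : ∀ p : MvPolynomial (Coord.{u} (Fintype.card F ^ n)) F,
      (∀ (L' : Type u) [Field L'] [Algebra F L'] (s : XTriple F L' j k n),
        MvPolynomial.aeval s.coord p = 0) →
      MvPolynomial.aeval (fun i => algebraMap L (AlgebraicClosure L) (c i)) p = 0) :
    ∃ s : XTriple F L j k n, ∀ i, s.coord i = algebraMap L (AlgebraicClosure L) (c i) := by
  let φ := NormalizedDrinfeldModule.ofCoeff F j k (c .g)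
  obtain ⟨ψ, hψ⟩ : ∃ ψ : MvPolynomial (Coord.{u} (Fintype.card F ^ n)) F →+* AlgebraicClosure L,
      ψ = (MvPolynomial.aeval (fun i => algebraMap L (AlgebraicClosure L) (c i)) :
        MvPolynomial (Coord.{u} (Fintype.card F ^ n)) F →ₐ[F] _).toRingHom := ⟨_, rfl⟩
  have hψX : ∀ i, ψ (MvPolynomial.X i) = algebraMap L (AlgebraicClosure L) (c i) := fun i => by
    simp [hψ]
  have hA : ∀ a v, ((genericAct (Fintype.card F ^ n) j k a).map ψ).eval v = φ.act a v := by
    rw [hψ]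
    exact eval_map_genericAct φ (fun i => algebraMap L (AlgebraicClosure L) (c i)) rfl
  replace h : ∀ p : MvPolynomial (Coord.{u} (Fintype.card F ^ n)) F,
      (∀ (L' : Type u) [Field L'] [Algebra F L'] (s : XTriple F L' j k n),
        MvPolynomial.aeval s.coord p = 0) → ψ p = 0 := by
    rw [hψ]
    exact h
  clear hψ
  let P := (genericEquation F (Fintype.card F ^ n)).map ψ
  have hPm : P.Monic := monic_genericEquation.map ψ
  have hx : -c .x ^ (Fintype.card F ^ (j + k) - 1) + c .g * c .x ^ (Fintype.card F ^ j - 1) + 1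
      = 0 := by
    have := h (-MvPolynomial.X .x ^ (Fintype.card F ^ (j + k) - 1) +
      MvPolynomial.X .g * MvPolynomial.X .x ^ (Fintype.card F ^ j - 1) + 1) fun L' _ _ s => by
        have := congrArg (algebraMap L' (AlgebraicClosure L')) s.act_X_x
        simpa [XTriple.coord] using this
    refine (algebraMap L (AlgebraicClosure L)).injective ?_
    simpa [hψX] using this
  have hx0 : c .x ≠ 0 := fun h0 => by
    have h1 : ∀ i, 1 ≤ i → Fintype.card F ^ i - 1 ≠ 0 := fun i hi => by
      have := Nat.one_lt_pow (n := i) (by omega) (Fintype.one_lt_card (α := F))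
      omega
    simp [h0, h1 j hj, h1 (j + k) (by omega)] at hx
  have hTx : φ.act X (algebraMap L (AlgebraicClosure L) (c .x)) = 0 := by
    have hpow : ∀ i, c .x ^ Fintype.card F ^ i = c .x ^ (Fintype.card F ^ i - 1) * c .x :=
      fun i => by
        rw [← pow_succ,
          Nat.sub_add_cancel (Nat.pos_of_ne_zero (pow_ne_zero _ Fintype.card_ne_zero))]
    rw [φ.act_X, ← map_pow, ← map_pow, ← map_mul, ← map_neg, ← map_add, ← map_add, hpow, hpow]
    have : -(c .x ^ (Fintype.card F ^ (j + k) - 1) * c .x) +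
        φ.g * (c .x ^ (Fintype.card F ^ j - 1) * c .x) + c .x = 0 := by
      have := congrArg (· * c .x) hx
      simp only [zero_mul] at this
      rw [← this]
      change _ + c .g * _ + _ = _
      ring
    rw [this, map_zero]
  -- A root of P above the marked point will be the generator: φ_{T^{n-1}}(v) = x ≠ 0 and φ_T(x) = 0
  -- force its annihilator to be T^n.
  obtain ⟨v, hPv, hv⟩ : ∃ v, P.eval v = 0 ∧
      φ.act (X ^ (n - 1)) v = algebraMap L (AlgebraicClosure L) (c .x) := by
    obtain ⟨v, h1, h2⟩ := exists_root_of_markedPointRelation ψ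
      (h _ fun L' _ _ s => s.aeval_markedPointRelation hn)
    exact ⟨v, h1, by rw [← hA, h2, hψX]⟩
  have hstab : ∀ a w, P.eval w = 0 → P.eval (φ.act a w) = 0 := by
    intro a w hw
    have hdvd : P ∣ P.comp ((genericAct (Fintype.card F ^ n) j k a).map ψ) := by
      rw [← modByMonic_eq_zero_iff_dvd hPm, ← Polynomial.map_comp,
        ← map_modByMonic ψ monic_genericEquation]
      ext i
      rw [coeff_map, coeff_zero]
      exact h _ fun L' _ _ s => s.aeval_coeff_modByMonic_eq_zero a i
    obtain ⟨Q, hQ⟩ := hdvd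
    rw [← hA, ← eval_comp, hQ, eval_mul, hw, zero_mul]
  have hvn : φ.act (X ^ n) v = 0 := by
    rw [← Nat.sub_add_cancel hn, pow_succ', φ.act_mul, hv, hTx]
  have hann := X_pow_dvd_of_act_eq_zero hn φ hvn (by
    rw [hv]
    exact (_root_.map_ne_zero _).2 hx0)
  have hcard : (φ.orbit v : Set (AlgebraicClosure L)).ncard = Fintype.card F ^ n := by
    have := ((isSubmoduleIsoQuotient_iff φ.actHom.toRingHom (φ.orbit v).toAddSubgroup
      (Ideal.span {X ^ n})).2 ⟨v, fun w => Iff.rfl, fun a =>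
        (hann a).trans Ideal.mem_span_singleton.symm⟩).natCard_eq
    rw [natCard_quotient_span_singleton _ (pow_ne_zero _ X_ne_zero), natDegree_X_pow,
      Nat.card_eq_fintype_card (α := F)] at this
    exact this
  have hfin : (φ.orbit v : Set (AlgebraicClosure L)).Finite :=
    Set.finite_of_ncard_ne_zero (hcard ▸ pow_ne_zero _ Fintype.card_ne_zero)
  have hPd : P.natDegree = Fintype.card F ^ n := by
    rw [(monic_genericEquation (S := F) (d := Fintype.card F ^ n)).natDegree_map,
      natDegree_genericEquation]
  -- The q^n elements of Av are roots of P, which is monic of degree q^n; there is no room for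
  -- others.
  have hPeq : P = equation (φ.orbit v : Set (AlgebraicClosure L)) := by
    refine eq_of_monic_of_dvd_of_natDegree_le (monic_equation hfin) hPm
      ((equation_dvd_iff hfin _).2 ?_) ?_
    · rintro _ ⟨a, rfl⟩
      exact hstab a v hPv
    · rw [hPd, natDegree_equation hfin, hcard]
  have hcoeff : ∀ i : Fin (Fintype.card F ^ n), P.coeff i = algebraMap L (AlgebraicClosure L) (c (.coeff i)) := by
    intro i
    rw [coeff_map, coeff_genericEquation, hψX]
  have hPgal : ∀ ξ : AlgebraicClosure L ≃ₐ[L] AlgebraicClosure L,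
      P.map (ξ : AlgebraicClosure L →+* AlgebraicClosure L) = P := by
    intro ξ
    rw [Monic.eq_X_pow_add_sum hPm hPd]
    simp [Polynomial.map_sum, hcoeff]
  -- P has coefficients in L, so automorphisms permute its roots.
  have hgal : IsGaloisStable (φ.orbit v : Set (AlgebraicClosure L)) := by
    refine isGaloisStable_of_forall fun ξ w hw => ?_
    rw [← eval_equation_eq_zero hfin, ← hPeq] at hw ⊢
    rw [← hPgal ξ]
    exact (eval_map_apply (ξ : AlgebraicClosure L →+* AlgebraicClosure L) w).trans (by simp [hw])
  have hG : φ.orbit v ∈ levelX φ (X ^ n) :=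
    NormalizedDrinfeldModule.mem_levelX_iff.2 ⟨⟨v, rfl, hann⟩, hgal⟩
  refine ⟨⟨φ, φ.orbit v, hG, c .x, hx0, ⟨⟨X ^ (n - 1), hv⟩, hTx⟩⟩, fun i => ?_⟩
  cases i with
  | g => rfl
  | x => rfl
  | coeff i => exact (congrArg (coeff · (i : ℕ)) hPeq).symm.trans (hcoeff i)

end Triples

/-! ### Points of affine schemes over a field -/

section Points

variable {K : Type u} [Field K] {S S' S'' : Type u} [CommRing S] [Algebra K S] [CommRing S']
  [Algebra K S'] [CommRing S''] [Algebra K S'']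

/-- The morphism of schemes over `K` that a homomorphism of `K`-algebras defines. -/
def specMap (f : S →ₐ[K] S') : specOver K S' ⟶ specOver K S :=
  Over.homMk (Spec.map (CommRingCat.ofHom f.toRingHom)) (by
    change Spec.map _ ≫ Spec.map _ = Spec.map _
    rw [← Spec.map_comp, ← CommRingCat.ofHom_comp, AlgHom.toRingHom_eq_coe, f.comp_algebraMap])

theorem specMap_comp (f : S →ₐ[K] S') (g : S' →ₐ[K] S'') :
    specMap (g.comp f) = specMap g ≫ specMap f := by
  ext1
  change Spec.map _ = Spec.map _ ≫ Spec.map _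
  rw [← Spec.map_comp]
  rfl

theorem specMap_id : specMap (AlgHom.id K S) = 𝟙 _ := by
  ext1
  exact Spec.map_id _

theorem valueAt_specMap (f : S →ₐ[K] S') (s : S) : valueAt (specMap f) s = f s := by
  change (Spec.preimage (Spec.map (CommRingCat.ofHom f.toRingHom))).hom s = f s
  rw [Spec.preimage_map]
  rfl

theorem specMap_injective : Function.Injective (specMap : (S →ₐ[K] S') → _) := fun f g h => by
  ext s
  rw [← valueAt_specMap, h, valueAt_specMap]

theorem specMap_surjective : Function.Surjective (specMap : (S →ₐ[K] S') → _) := fun P => by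
  let f : S →ₐ[K] S' :=
    { (Spec.preimage P.left).hom with
      commutes' := fun r => by
        have h : P.left ≫ Spec.map (CommRingCat.ofHom (algebraMap K S)) =
            Spec.map (CommRingCat.ofHom (algebraMap K S')) := Over.w P
        rw [← Spec.map_preimage P.left, ← Spec.map_comp] at h
        exact congrArg (fun f => f.hom r) (Spec.map_injective h) }
  refine ⟨f, ?_⟩
  ext1
  exact Spec.map_preimage P.left

/-- The isomorphism of schemes over `K` that an isomorphism of `K`-algebras defines. -/
def specIso (ε : S ≃ₐ[K] S') : specOver K S' ≅ specOver K S where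
  hom := specMap ε.toAlgHom
  inv := specMap ε.symm.toAlgHom
  hom_inv_id := by
    rw [← specMap_comp, ← specMap_id]
    congr 1
    ext s
    simp
  inv_hom_id := by
    rw [← specMap_comp, ← specMap_id]
    congr 1
    ext s
    simp

theorem exists_point {ι L : Type u} [Field L] [Algebra K L] (I : Ideal (MvPolynomial ι K))
    (c : ι → AlgebraicClosure L)
    (hc : ∀ i, c i ∈ Set.range (algebraMap L (AlgebraicClosure L)))
    (hI : ∀ p ∈ I, MvPolynomial.aeval c p = 0) :
    ∃ f : (MvPolynomial ι K ⧸ I) →ₐ[K] L, ∀ p,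
      algebraMap L (AlgebraicClosure L) (f (Ideal.Quotient.mk I p)) = MvPolynomial.aeval c p := by
  choose l hl using hc
  have key : ∀ p : MvPolynomial ι K,
      algebraMap L (AlgebraicClosure L) (MvPolynomial.aeval l p) = MvPolynomial.aeval c p := by
    intro p
    rw [← MvPolynomial.aeval_algebraMap_apply]
    congr 2
    exact funext hl
  refine ⟨Ideal.Quotient.liftₐ I (MvPolynomial.aeval l) fun p hp => ?_, key⟩
  refine (algebraMap L (AlgebraicClosure L)).injective ?_
  rw [key, hI p hp, map_zero]

theorem quotient_algHom_ext {ι T : Type u} [CommRing T] [Algebra K T]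
    {I : Ideal (MvPolynomial ι K)} {f g : (MvPolynomial ι K ⧸ I) →ₐ[K] T}
    (h : ∀ i, f (Ideal.Quotient.mk I (MvPolynomial.X i)) =
      g (Ideal.Quotient.mk I (MvPolynomial.X i))) : f = g :=
  Ideal.Quotient.algHom_ext _ (MvPolynomial.algHom_ext h)

end Points

/-! ### Passage from polynomials over F to polynomials over K -/

section BaseChange

variable {F K : Type u} [Field F] [Field K] [Algebra F K]

theorem aeval_map_algebraMap_coord {L : Type u} [Field L] [Algebra F L] [Algebra K L]
    [IsScalarTower F K L] {ι : Type u} (c : ι → AlgebraicClosure L) (p : MvPolynomial ι F) :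
    MvPolynomial.aeval c (MvPolynomial.map (algebraMap F K) p) = MvPolynomial.aeval c p :=
  MvPolynomial.aeval_map_algebraMap K c p

/-- Polynomial formulas for coordinates in terms of other coordinates. -/
theorem aeval_aeval_map {L : Type u} [Field L] [Algebra F L] [Algebra K L]
    [IsScalarTower F K L] {ι κ : Type u} (a : ι → MvPolynomial κ F)
    (c : κ → AlgebraicClosure L) (p : MvPolynomial ι K) :
    MvPolynomial.aeval c (MvPolynomial.aeval
      (fun i => MvPolynomial.map (algebraMap F K) (a i)) p) =
      MvPolynomial.aeval (fun i => MvPolynomial.aeval c (a i)) p := by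
  rw [← AlgHom.comp_apply, MvPolynomial.comp_aeval]
  simp only [aeval_map_algebraMap_coord]

end BaseChange

/-! ### The curves -/

section CurveIso

variable {F K : Type u} [Field F] [Fintype F] [Field K] [Algebra F K] {j k n : ℕ}

theorem mem_idealX {p : MvPolynomial (Coord.{u} (Fintype.card F ^ n)) K} :
    p ∈ idealX F K j k n ↔ ∀ (L : Type u) [Field L] [Algebra F L] [Algebra K L]
      [IsScalarTower F K L] (s : XTriple F L j k n), MvPolynomial.aeval s.coord p = 0 := by
  simp only [idealX, Ideal.mem_iInf, RingHom.mem_ker]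

theorem mem_idealM {p : MvPolynomial (Coord.{u} (Fintype.card F ^ (k * n))) K} :
    p ∈ idealM F K j k n ↔ ∀ (L : Type u) [Field L] [Algebra F L] [Algebra K L]
      [IsScalarTower F K L] (t : MTriple F L j k n), MvPolynomial.aeval t.coord p = 0 := by
  simp only [idealM, Ideal.mem_iInf, RingHom.mem_ker]

variable (K) in
/-- The isomorphism of coordinate rings, given by polynomials in the coordinates. -/
theorem exists_coordRing_equiv (hj : 1 ≤ j) (hk : 1 ≤ k) (hjk : j.Coprime k) (hp : (k : F) ≠ 0)
    (hn : 1 ≤ n) : ∃ ε : CoordRingX F K j k n ≃ₐ[K] CoordRingM F K j k n,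
      ∀ c, ∃ b : MvPolynomial (Coord.{u} (Fintype.card F ^ n)) K,
        ε.symm (Ideal.Quotient.mk _ (MvPolynomial.X c)) = Ideal.Quotient.mk _ b ∧
        ∀ (L : Type u) [Field L] [Algebra F L] [Algebra K L] [IsScalarTower F K L]
          (t : MTriple F L j k n),
          MvPolynomial.aeval (levelEquiv hk hjk hp hn t).coord b = t.coord c := by
  obtain ⟨a, ha⟩ := exists_coordX_eq_aeval_coordM F j k n hj hk hp
  obtain ⟨b, hb⟩ := exists_coordM_eq_aeval_coordX F j k n hk hjk hp
  have ha' : ∀ (L : Type u) [Field L] [Algebra F L] (t : MTriple F L j k n),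
      (fun c => MvPolynomial.aeval t.coord (a c)) = (levelEquiv hk hjk hp hn t).coord :=
    fun L _ _ t => funext (ha L t _ rfl rfl (coe_levelEquiv_G hk hjk hp hn t))
  have hb' : ∀ (L : Type u) [Field L] [Algebra F L] (s : XTriple F L j k n),
      (fun c => MvPolynomial.aeval s.coord (b c)) = ((levelEquiv hk hjk hp hn).symm s).coord :=
    fun L _ _ s => funext (hb L _ s rfl rfl rfl)
  let A := MvPolynomial.aeval (R := K) fun c => MvPolynomial.map (algebraMap F K) (a c)
  let B := MvPolynomial.aeval (R := K) fun c => MvPolynomial.map (algebraMap F K) (b c)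
  let f : CoordRingX F K j k n →ₐ[K] CoordRingM F K j k n :=
    Ideal.quotientMapₐ (idealM F K j k n) A fun p hp => by
      rw [Ideal.mem_comap, mem_idealM]
      intro L _ _ _ _ t
      exact (aeval_aeval_map a t.coord p).trans (by rw [ha']; exact mem_idealX.1 hp L _)
  let g : CoordRingM F K j k n →ₐ[K] CoordRingX F K j k n :=
    Ideal.quotientMapₐ (idealX F K j k n) B fun p hp => by
      rw [Ideal.mem_comap, mem_idealX]
      intro L _ _ _ _ s
      exact (aeval_aeval_map b s.coord p).trans (by rw [hb']; exact mem_idealM.1 hp L _)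
  -- Two polynomials agree in the coordinate ring as soon as they agree at all triples, and there
  -- the substitutions realize the bijection and its inverse.
  have hfg : f.comp g = AlgHom.id K _ := by
    refine quotient_algHom_ext fun c => ?_
    change Ideal.Quotient.mk (idealM F K j k n) (A (B (MvPolynomial.X c))) = Ideal.Quotient.mk _ _
    rw [Ideal.Quotient.eq, mem_idealM]
    intro L _ _ _ _ t
    rw [map_sub, sub_eq_zero]
    refine (aeval_aeval_map a t.coord _).trans ?_
    rw [ha']
    refine (aeval_aeval_map b _ _).trans ?_
    rw [hb', Equiv.symm_apply_apply]
  have hgf : g.comp f = AlgHom.id K _ := by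
    refine quotient_algHom_ext fun c => ?_
    change Ideal.Quotient.mk (idealX F K j k n) (B (A (MvPolynomial.X c))) = Ideal.Quotient.mk _ _
    rw [Ideal.Quotient.eq, mem_idealX]
    intro L _ _ _ _ s
    rw [map_sub, sub_eq_zero]
    refine (aeval_aeval_map b s.coord _).trans ?_
    rw [hb']
    refine (aeval_aeval_map a _ _).trans ?_
    rw [ha', Equiv.apply_symm_apply]
  refine ⟨AlgEquiv.ofAlgHom f g hfg hgf, fun c =>
    ⟨B (MvPolynomial.X c), rfl, fun L _ _ _ _ t => ?_⟩⟩
  refine (aeval_aeval_map b _ _).trans ?_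
  rw [hb', Equiv.symm_apply_apply, MvPolynomial.aeval_X]

/-- The points of `Ẍ_{m,j}(T^n)` are the triples. -/
theorem exists_points_equiv (hj : 1 ≤ j) (hn : 1 ≤ n) (L : Type u) [Field L] [Algebra F L]
    [Algebra K L] [IsScalarTower F K L] :
    ∃ ptX : XTriple F L j k n ≃ (specOver K L ⟶ curveX F K j k n), ∀ s p,
      algebraMap L (AlgebraicClosure L) (valueAt (ptX s) (Ideal.Quotient.mk _ p)) =
        MvPolynomial.aeval s.coord p := by
  choose f hf using fun s : XTriple F L j k n => exists_point (idealX F K j k n) s.coord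
    (s.coord_mem_range hj) fun p hp => mem_idealX.1 hp L s
  have hinj := (algebraMap L (AlgebraicClosure L)).injective
  have hbij : Function.Bijective fun s => (specMap (f s) : specOver K L ⟶ curveX F K j k n) := by
    refine ⟨fun s s' h => ?_, fun P => ?_⟩
    · refine XTriple.coord_injective (funext fun c => ?_)
      have h1 := hf s (MvPolynomial.X c)
      rw [specMap_injective h, hf, MvPolynomial.aeval_X, MvPolynomial.aeval_X] at h1
      exact h1.symm
    · obtain ⟨g, rfl⟩ := specMap_surjective P
      obtain ⟨s, hs⟩ := exists_XTriple_of_forall_aeval_eq_zero (F := F) (k := k) hj hn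
        (fun c => g (Ideal.Quotient.mk _ (MvPolynomial.X c))) fun p hp => by
          -- A polynomial over F that vanishes at all triples over extensions of F vanishes in
          -- particular over extensions of K, hence at the given point.
          have h1 : MvPolynomial.map (algebraMap F K) p ∈ idealX F K j k n :=
            mem_idealX.2 fun L' _ _ _ _ s => (aeval_map_algebraMap_coord _ p).trans (hp L' s)
          have h2 : ∀ p, algebraMap L (AlgebraicClosure L) (g (Ideal.Quotient.mk _ p)) =
              MvPolynomial.aeval (fun i => algebraMap L (AlgebraicClosure L)
                (g (Ideal.Quotient.mk _ (MvPolynomial.X i)))) p := fun p => by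
            refine Eq.trans ?_ (MvPolynomial.aeval_algebraMap_apply (AlgebraicClosure L)
              (fun i => g (Ideal.Quotient.mk _ (MvPolynomial.X i))) p).symm
            refine congrArg _ ?_
            exact DFunLike.congr_fun (MvPolynomial.aeval_unique
              (g.comp (Ideal.Quotient.mkₐ K (idealX F K j k n)))) p
          rw [← aeval_map_algebraMap_coord (K := K), ← h2, Ideal.Quotient.eq_zero_iff_mem.2 h1,
            map_zero, map_zero]
      refine ⟨s, congrArg specMap (quotient_algHom_ext fun c => hinj ?_)⟩
      rw [hf, MvPolynomial.aeval_X, hs]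
  refine ⟨Equiv.ofBijective _ hbij, fun s p => ?_⟩
  rw [← hf s p]
  exact congrArg _ (valueAt_specMap (f s) _)

theorem valueAt_comp_specMap {S S' L : Type u} [CommRing S] [Algebra K S] [CommRing S']
    [Algebra K S'] [CommRing L] [Algebra K L] (P : specOver K L ⟶ specOver K S)
    (f : S' →ₐ[K] S) (s : S') : valueAt (P ≫ specMap f) s = valueAt P (f s) := by
  obtain ⟨g, rfl⟩ := specMap_surjective P
  rw [← specMap_comp, valueAt_specMap, valueAt_specMap]
  rfl

end CurveIso

end

end DrinfeldCurve

theorem mainTheorem2 {F K : Type u} [Field F] [Fintype F] [Field K] [Algebra F K]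
    (j k n : ℕ) (hj : 1 ≤ j) (hk : 1 ≤ k) (hjk : Nat.Coprime j k) (hp : ¬ ringChar F ∣ k)
    (hK : Module.finrank F K = j + k) (hn : 1 ≤ n) :
    ∃ e : DrinfeldCurve.curveM F K j k n ≅ DrinfeldCurve.curveX F K j k n,
      ∀ (L : Type u) [Field L] [Algebra F L] [Algebra K L] [IsScalarTower F K L],
        ∃ (ptM : DrinfeldCurve.MTriple F L j k n ≃
              (DrinfeldCurve.specOver K L ⟶ DrinfeldCurve.curveM F K j k n))
          (ptX : DrinfeldCurve.XTriple F L j k n ≃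
              (DrinfeldCurve.specOver K L ⟶ DrinfeldCurve.curveX F K j k n))
          (α : DrinfeldCurve.MTriple F L j k n ≃ DrinfeldCurve.XTriple F L j k n),
          (∀ t c, algebraMap L (AlgebraicClosure L) (DrinfeldCurve.valueAt (ptM t)
              (Ideal.Quotient.mk _ (MvPolynomial.X c))) = t.coord c) ∧
          (∀ s c, algebraMap L (AlgebraicClosure L) (DrinfeldCurve.valueAt (ptX s)
              (Ideal.Quotient.mk _ (MvPolynomial.X c))) = s.coord c) ∧
          (∀ t, (α t).φ = t.φ ∧ (α t).x = t.x ∧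
            ((α t).G : Set (AlgebraicClosure L)) =
              t.φ.act (DrinfeldCurve.smallF F k ^ n) '' (t.E : Set (AlgebraicClosure L))) ∧
          (∀ s, (α.symm s).φ = s.φ ∧ (α.symm s).x = s.x ∧
            (α.symm s).E =
              Submodule.span (DrinfeldCurve.fqk F L k) (s.G : Set (AlgebraicClosure L))) ∧
          (∀ t, ptM t ≫ e.hom = ptX (α t)) := by
  have hp' : (k : F) ≠ 0 := fun h => hp ((ringChar.spec F k).1 h)
  obtain ⟨ε, hε⟩ := DrinfeldCurve.exists_coordRing_equiv (F := F) K hj hk hjk hp' hn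
  refine ⟨DrinfeldCurve.specIso ε, fun L _ _ _ _ => ?_⟩
  obtain ⟨ptX, hX⟩ := DrinfeldCurve.exists_points_equiv (F := F) (K := K) (k := k) hj hn L
  let α := DrinfeldCurve.levelEquiv (F := F) (L := L) hk hjk hp' hn
  -- Points of M̈ are defined by transport through e and α, so compatibility with e is formal. The
  -- coordinates of E at such a point are read off from the polynomials that express them in the
  -- coordinates of G.
  refine ⟨(α.trans ptX).trans (DrinfeldCurve.specIso ε).symm.homToEquiv, ptX, α,
    fun t c => ?_, fun s c => (hX s _).trans (MvPolynomial.aeval_X _ _),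
    fun t => ⟨rfl, rfl, DrinfeldCurve.coe_levelEquiv_G hk hjk hp' hn t⟩,
    fun s => ⟨rfl, rfl, rfl⟩, fun t => ?_⟩
  · obtain ⟨b, hb, hbt⟩ := hε c
    refine Eq.trans ?_ ((hX (α t) b).trans (hbt L t))
    refine congrArg _ ((DrinfeldCurve.valueAt_comp_specMap (ptX (α t)) ε.symm.toAlgHom _).trans ?_)
    exact congrArg _ hb
  · exact (Category.assoc _ _ _).trans
      ((congrArg _ (DrinfeldCurve.specIso ε).inv_hom_id).trans (Category.comp_id _))
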